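/- Let $A$ be a finite-dimensional quantum system. Write $\mathcal D_A$ for the set of states of $A$ (positive semidefinite operators of trace one) and $\mathrm{aff}(\mathcal D_A)$ for the set of Hermitian operators of trace one; for Hermitian $\gamma$, let $\mathrm{supp}(\gamma)$ be its range. For positive semidefinite $\sigma$, negative powers and the logarithm of $\sigma$ are taken on $\mathrm{supp}(\sigma)$ (and are $0$ on its orthogonal complement). Let $\mathcal P_r$ be the set of probability distributions on $\{1,\dots,r\}$. Let $p=(p_1,\dots,p_r)\in\mathcal P_r$ with $p_x>0$ for all $x$, let $\rho_1,\dots,\rho_r\in\mathcal D_A$, and for $n\ge 1$ let $$P_{\mathrm{err}}(\mathcal E^n)=\inf_{\Lambda}\sum_{x=1}^r p_x\,\mathrm{Tr}[\Lambda_x\rho_x^{\otimes n}],$$ where the infimum is over all POVMs $\Lambda=(\Lambda_1,\dots,\Lambda_r)$ on $A^n$ (that is, $\Lambda_x\ge0$ and $\sum_x\Lambda_x=I$). For $\alpha>1$, Hermitian $\gamma\ne0$ and $\sigma\ge0$, let $$\widetilde D_\alpha(\gamma\|\sigma)=\frac1{\alpha-1}\ln\bigl\|\sigma^{\frac{1-\alpha}{2\alpha}}\gamma\,\sigma^{\frac{1-\alpha}{2\alpha}}\bigr\|_\alpha^\alpha$$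 if $\mathrm{supp}(\gamma)\subseteq\mathrm{supp}(\sigma)$ and $+\infty$ otherwise, where $\|\gamma\|_\alpha=(\mathrm{Tr}[(\gamma^\dagger\gamma)^{\alpha/2}])^{1/\alpha}$. For a state $\tau$ and $\sigma\ge0$, let $D(\tau\|\sigma)=\mathrm{Tr}[\tau(\ln\tau-\ln\sigma)]$ if $\mathrm{supp}(\tau)\subseteq\mathrm{supp}(\sigma)$ and $+\infty$ otherwise. Use the conventions $-\ln0=+\infty$ and $0\cdot(+\infty)=0$. For every $s\in\mathcal P_r$ the limit $\lim_{\varepsilon\searrow0}-\ln\mathrm{Tr}\bigl[\exp\bigl(\sum_{x}s_x\ln(\rho_x+\varepsilon I)\bigr)\bigr]$ exists in $[-\infty,+\infty]$; let $$C^\flat(\rho_1,\dots,\rho_r)=\sup_{s\in\mathcal P_r}\ \lim_{\varepsilon\searrow0}-\ln\mathrm{Tr}\Bigl[\exp\Bigl(\sum_{x=1}^r s_x\ln(\rho_x+\varepsilon I)\Bigr)\Bigr]$$ be the multivariate log-Euclidean Chernoff divergence. Then $$\limsup_{n\to\infty}-\frac1n\ln P_{\mathrm{err}}(\mathcal E^n)\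 \le\ \inf_{\alpha>1}\ \limsup_{n\to\infty}\ \sup_{s\in\mathcal P_r}\ \inf_{\tau_n\in\mathrm{aff}(\mathcal D_{A^n})}\ \frac1n\sum_{x=1}^r s_x\,\widetilde D_\alpha(\tau_n\|\rho_x^{\otimes n})\ \le\ C^\flat(\rho_1,\dots,\rho_r),$$ and in particular $$\limsup_{n\to\infty}-\frac1n\ln P_{\mathrm{err}}(\mathcal E^n)\le C^\flat(\rho_1,\dots,\rho_r).$$ Moreover, $C^\flat(\rho_1,\dots,\rho_r)$ equals the left Umegaki radius: $$C^\flat(\rho_1,\dots,\rho_r)=\inf_{\tau\in\mathcal D_A}\ \max_{1\le x\le r} D(\tau\|\rho_x).$$ -/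

import Mathlib

open Filter Topology
open scoped ComplexOrder

namespace StateExclusion

noncomputable section

/-- A quantum state of a finite-dimensional system: a positive semidefinite operator of trace one. -/
def IsState {A : Type*} [Fintype A] (ρ : Matrix A A ℂ) : Prop :=
  ρ.PosSemidef ∧ ρ.trace = 1

/-- The set of quantum states. -/
def states (A : Type*) [Fintype A] : Set (Matrix A A ℂ) :=
  {ρ | IsState ρ}

/-- The affine hull of the set of states: the Hermitian operators of trace one. -/
def affStates (A : Type*) [Fintype A] : Set (Matrix A A ℂ) :=
  {τ | τ.IsHermitian ∧ τ.trace = 1}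

/-- The support of a Hermitian operator, that is, its range. -/
def supp {A : Type*} [Fintype A] (γ : Matrix A A ℂ) : Submodule ℂ (A → ℂ) :=
  LinearMap.range γ.mulVecLin

/-- The `n`-fold tensor power of an operator; the `n`-fold composite system of a system with
orthonormal basis indexed by `A` has its product basis indexed by `Fin n → A`. -/
def tensorPow {A : Type*} (n : ℕ) (M : Matrix A A ℂ) : Matrix (Fin n → A) (Fin n → A) ℂ :=
  Matrix.of fun i j => ∏ k, M (i k) (j k)

/-- `σ ^ p` for a positive semidefinite `σ` and a real exponent `p ≠ 0`, taken on the support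
of `σ` (on the kernel, `(0 : ℝ) ^ p = 0` for `p ≠ 0`). -/
def powOnSupp {A : Type*} [Fintype A] [DecidableEq A] (σ : Matrix A A ℂ) (p : ℝ) :
    Matrix A A ℂ :=
  cfc (fun t : ℝ => t ^ p) σ

/-- `ln σ` for a positive semidefinite `σ`, taken on the support of `σ`
(on the kernel, `Real.log 0 = 0`). -/
def logOnSupp {A : Type*} [Fintype A] [DecidableEq A] (σ : Matrix A A ℂ) : Matrix A A ℂ :=
  cfc Real.log σ

/-- `exp H` for a Hermitian operator `H`. -/
def expHerm {A : Type*} [Fintype A] [DecidableEq A] (H : Matrix A A ℂ) : Matrix A A ℂ :=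
  cfc Real.exp H

/-- The extended-real number `-ln t` for a real `t ≥ 0`, with `-ln 0 = +∞`. -/
def negLog (t : ℝ) : EReal :=
  -ENNReal.log (ENNReal.ofReal t)

/-- The `α`-norm `(Tr[(γ† γ)^(α/2)])^(1/α)` of an operator. -/
def schattenNorm {A : Type*} [Fintype A] [DecidableEq A] (α : ℝ) (γ : Matrix A A ℂ) : ℝ :=
  (powOnSupp (γ.conjTranspose * γ) (α / 2)).trace.re ^ (1 / α)

open Classical in
/-- The extended sandwiched Rényi divergence of order `α > 1`, for a Hermitian `γ ≠ 0` and a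
positive semidefinite `σ`. -/
def sandwichedRenyi {A : Type*} [Fintype A] [DecidableEq A] (α : ℝ) (γ σ : Matrix A A ℂ) :
    EReal :=
  if supp γ ≤ supp σ then
    ((1 / (α - 1) * Real.log (schattenNorm α
      (powOnSupp σ ((1 - α) / (2 * α)) * γ * powOnSupp σ ((1 - α) / (2 * α))) ^ α) : ℝ) : EReal)
  else ⊤

open Classical in
/-- The Umegaki divergence (quantum relative entropy) of a state `ρ` and a positive semidefinite
operator `σ`. -/
def umegaki {A : Type*} [Fintype A] [DecidableEq A] (ρ σ : Matrix A A ℂ) : EReal :=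
  if supp ρ ≤ supp σ then
    (((ρ * (logOnSupp ρ - logOnSupp σ)).trace.re : ℝ) : EReal)
  else ⊤

/-- The left Umegaki radius of a (nonempty) tuple of positive semidefinite operators. -/
def umegakiRadius {A : Type*} [Fintype A] [DecidableEq A] {r : ℕ} (ρ : Fin r → Matrix A A ℂ) :
    EReal :=
  ⨅ τ ∈ states A, ⨆ x, umegaki τ (ρ x)

/-- `-ln Tr[exp(∑ₓ sₓ ln(ρₓ + ε I))]`. -/
def logEuclideanReg {A : Type*} [Fintype A] [DecidableEq A] {r : ℕ}
    (ρ : Fin r → Matrix A A ℂ) (s : Fin r → ℝ) (ε : ℝ) : EReal :=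
  negLog (expHerm (∑ x, s x • logOnSupp (ρ x + ε • (1 : Matrix A A ℂ)))).trace.re

/-- The multivariate log-Euclidean Chernoff divergence
`sup_s lim_{ε ↘ 0} -ln Tr[exp(∑ₓ sₓ ln(ρₓ + ε I))]`, the supremum being over all probability
distributions `s`. -/
def logEuclideanChernoff {A : Type*} [Fintype A] [DecidableEq A] {r : ℕ}
    (ρ : Fin r → Matrix A A ℂ) : EReal :=
  ⨆ s ∈ stdSimplex ℝ (Fin r), limUnder (𝓝[>] (0 : ℝ)) (logEuclideanReg ρ s)

/-- A POVM with `r` outcomes. -/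
def IsPOVM {A : Type*} [Fintype A] [DecidableEq A] {r : ℕ} (Λ : Fin r → Matrix A A ℂ) : Prop :=
  (∀ x, (Λ x).PosSemidef) ∧ ∑ x, Λ x = 1

/-- The error probability of state exclusion for the ensemble `(p, ρ)`: the infimum over all
POVMs `Λ` of `∑ₓ pₓ Tr[Λₓ ρₓ]`. -/
def errorProb {A : Type*} [Fintype A] [DecidableEq A] {r : ℕ} (p : Fin r → ℝ)
    (ρ : Fin r → Matrix A A ℂ) : ℝ :=
  sInf {e : ℝ | ∃ Λ : Fin r → Matrix A A ℂ, IsPOVM Λ ∧ e = ∑ x, p x * (Λ x * ρ x).trace.re}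

/-- `limsup_n -(1/n) ln P_err` for the `n`-fold ensembles `(p, (ρₓ^{⊗ n})ₓ)`. -/
def errorExponentLimsup {A : Type*} [Fintype A] [DecidableEq A] {r : ℕ} (p : Fin r → ℝ)
    (ρ : Fin r → Matrix A A ℂ) : EReal :=
  limsup (fun n : ℕ => ((1 / (n : ℝ) : ℝ) : EReal) *
    negLog (errorProb p (fun x => tensorPow n (ρ x)))) atTop

/-- The infimum over `α > 1` of the regularized extended left sandwiched Rényi radius,
`inf_{α > 1} limsup_n sup_s inf_{τₙ ∈ aff(states)} (1/n) ∑ₓ sₓ D_α(τₙ ‖ ρₓ^{⊗ n})`. -/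
def regularizedRadius {A : Type*} [Fintype A] [DecidableEq A] {r : ℕ}
    (ρ : Fin r → Matrix A A ℂ) : EReal :=
  ⨅ α ∈ Set.Ioi (1 : ℝ), limsup (fun n : ℕ =>
    ⨆ s ∈ stdSimplex ℝ (Fin r), ⨅ τ ∈ affStates (Fin n → A),
      ((1 / (n : ℝ) : ℝ) : EReal) *
        ∑ x, ((s x : ℝ) : EReal) * sandwichedRenyi α τ (tensorPow n (ρ x))) atTop

end

end StateExclusion

open StateExclusion

/-!
The exponent of the error probability is compared with the Umegaki radius through divergences of
Hermitian operators of trace one on many copies.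

*Converse.* Hölder's inequality and a special case of the Araki–Lieb–Thirring inequality give
`|Tr Λ τ| ≤ ‖σ^((1-α)/2α) τ σ^((1-α)/2α)‖_α (Tr Λ σ)^((α-1)/α)` for a test `0 ≤ Λ ≤ 1`
(`abs_trace_mul_le`). As the outcomes of a POVM have total weight `1` in `τ`, one of them has weight
at least `1/r`, so that for every `τ` the error exponent is at most the largest of the numbers
`D_α(τ‖ρₓ^{⊗ n}) / n` (`errorExponentLimsup_le`).

*Exchanging supremum and infimum.* The divergence of order `α > 1` is not convex in its first
argument, so that a minimax theorem does not apply for a fixed `n`. But it is additive under tensor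
products, so that for every `v` the vectors `(D_α(τ‖ρₓ^{⊗ n}) - n v)ₓ`, for `n` and `τ` varying
together, form an additive semigroup. The closure of its positive rational multiples is a convex
cone. For `v` below the error exponent it does not meet the open negative orthant, and separating
the two (`exists_stdSimplex_of_add_mem`) yields one distribution `s` that serves all `n` and `τ` at
once. This is the bound of the error exponent by the regularized radius.

*Orders near one.* For tensor powers of one state `τ`, the regularized radius is at most
`maxₓ D_α(τ‖ρₓ)`, and `D_α(τ‖ρₓ)` is asymptotically at most `D(τ‖ρₓ)` as `α ↘ 1`. The latter follows
from a bound of the norm in terms of spectra and overlaps (`schattenNorm_sandwich_rpow_le`), which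
reduces the limit to a derivative of elementary functions (`eventually_renyiReal_le`).

*The radius.* By the Gibbs variational principle, `-ln Tr exp(∑ₓ sₓ ln(ρₓ + ε))` is the minimum of
`∑ₓ sₓ D(τ‖ρₓ + ε)` over states `τ`. It is antitone in `ε`, so that the limit is a supremum. For
fixed `ε` the divergences are convex in `τ`, and separation from an orthant gives the minimax
equality; the limit `ε ↘ 0` is then taken by compactness of the set of states.

Throughout, a Hermitian matrix is written as `W diag(d) W†` (`ofSpectrum`), and trace inequalities
come from Jensen's inequality for the diagonal entries of a Hermitian matrix in an orthonormal
basis.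
-/

set_option linter.unusedSectionVars false

namespace StateExclusion

open Matrix
open scoped Kronecker

section Matrices

variable {I J K : Type*} [Fintype I] [DecidableEq I] [Fintype J] [DecidableEq J]
  [Fintype K] [DecidableEq K]

/-! ### Spectral decompositions and weights -/

/-- A unitary matrix whose rows and columns may be indexed by different types, so that reindexing
a tensor product is a special case of conjugation by a unitary. -/
def IsUnitaryMat (W : Matrix I J ℂ) : Prop :=
  Wᴴ * W = 1 ∧ W * Wᴴ = 1

/-- The Hermitian matrix `W diag(d) W†` with eigenvalues `d` and eigenvectors the columns of `W`. -/
noncomputable def ofSpectrum (W : Matrix I J ℂ) (d : J → ℝ) : Matrix I I ℂ :=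
  W * diagonal (fun j => (d j : ℂ)) * Wᴴ

/-- The real part of the `i`-th diagonal entry of `C† M C`, that is of `⟨cᵢ, M cᵢ⟩` for the `i`-th
column `cᵢ` of `C`. -/
noncomputable def quad (C : Matrix I J ℂ) (M : Matrix I I ℂ) (i : J) : ℝ :=
  ((Cᴴ * M * C) i i).re

/-- The overlap `|⟨vⱼ, cᵢ⟩|²` of the columns of two matrices. -/
noncomputable def overlap (V : Matrix I J ℂ) (C : Matrix I K ℂ) (j : J) (i : K) : ℝ :=
  Complex.normSq ((Vᴴ * C) j i)

lemma overlap_nonneg (V : Matrix I J ℂ) (C : Matrix I K ℂ) (j : J) (i : K) :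
    0 ≤ overlap V C j i := Complex.normSq_nonneg _

lemma isUnitaryMat_one : IsUnitaryMat (1 : Matrix I I ℂ) := by
  constructor <;> simp

lemma ofSpectrum_isHermitian (W : Matrix I J ℂ) (d : J → ℝ) : (ofSpectrum W d).IsHermitian := by
  unfold ofSpectrum Matrix.IsHermitian
  rw [conjTranspose_mul, conjTranspose_mul, conjTranspose_conjTranspose, diagonal_conjTranspose,
    Matrix.mul_assoc]
  congr 3
  ext j
  simp

lemma ofSpectrum_mul {W : Matrix I J ℂ} (hW : IsUnitaryMat W) (d e : J → ℝ) :
    ofSpectrum W d * ofSpectrum W e = ofSpectrum W (fun j => d j * e j) := by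
  unfold ofSpectrum
  calc _ = W * diagonal (fun j => (d j : ℂ)) * (Wᴴ * W) * diagonal (fun j => (e j : ℂ)) * Wᴴ := by
        simp only [Matrix.mul_assoc]
    _ = _ := by
        rw [hW.1, Matrix.mul_one, Matrix.mul_assoc W, diagonal_mul_diagonal]
        simp

lemma ofSpectrum_one {W : Matrix I J ℂ} (hW : IsUnitaryMat W) :
    ofSpectrum W (fun _ => 1) = 1 := by
  simp [ofSpectrum, hW.2]

lemma ofSpectrum_add (W : Matrix I J ℂ) (d e : J → ℝ) :
    ofSpectrum W d + ofSpectrum W e = ofSpectrum W (fun j => d j + e j) := by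
  unfold ofSpectrum
  rw [← Matrix.add_mul, ← Matrix.mul_add, diagonal_add]
  simp

lemma ofSpectrum_smul (W : Matrix I J ℂ) (c : ℝ) (d : J → ℝ) :
    c • ofSpectrum W d = ofSpectrum W (fun j => c * d j) := by
  unfold ofSpectrum
  rw [← Matrix.smul_mul, ← Matrix.mul_smul, ← diagonal_smul]
  congr 3
  ext j
  simp

lemma ofSpectrum_sub (W : Matrix I J ℂ) (d e : J → ℝ) :
    ofSpectrum W d - ofSpectrum W e = ofSpectrum W (fun j => d j - e j) := by
  unfold ofSpectrum
  rw [← Matrix.sub_mul, ← Matrix.mul_sub, diagonal_sub]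
  simp

lemma aeval_ofSpectrum {W : Matrix I J ℂ} (hW : IsUnitaryMat W) (d : J → ℝ)
    (q : Polynomial ℝ) :
    Polynomial.aeval (ofSpectrum W d) q = ofSpectrum W (fun j => q.eval (d j)) := by
  induction q using Polynomial.induction_on' with
  | add p q hp hq => simp only [map_add, hp, hq, ofSpectrum_add, Polynomial.eval_add]
  | monomial n a =>
    have hpow : ∀ n : ℕ, ofSpectrum W d ^ n = ofSpectrum W (fun j => d j ^ n) := by
      intro n
      induction n with
      | zero => simp [ofSpectrum_one hW]
      | succ n ih => simp only [pow_succ, ih, ofSpectrum_mul hW]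
    rw [Polynomial.aeval_monomial, hpow, ← Algebra.smul_def, ofSpectrum_smul]
    simp

/-- The functional calculus acts on the eigenvalues. No continuity of `f` is needed since the
spectrum is finite, so that `f` may be replaced by an interpolating polynomial. -/
lemma cfc_ofSpectrum {W : Matrix I J ℂ} (hW : IsUnitaryMat W) (d : J → ℝ) (f : ℝ → ℝ) :
    cfc f (ofSpectrum W d) = ofSpectrum W (fun j => f (d j)) := by
  classical
  have hH := ofSpectrum_isHermitian W d
  set S : Finset ℝ := (Matrix.finite_real_spectrum (A := ofSpectrum W d)).toFinset ∪
    Finset.univ.image d with hS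
  set q := Lagrange.interpolate S id f with hq
  have hev : ∀ t ∈ S, q.eval t = f t := fun t ht =>
    Lagrange.eval_interpolate_at_node f (Set.injOn_id _) ht
  have h1 : cfc f (ofSpectrum W d) = cfc q.eval (ofSpectrum W d) := by
    refine cfc_congr fun t ht => (hev t ?_).symm
    simp [hS, ht]
  rw [h1, cfc_polynomial q _ hH.isSelfAdjoint, aeval_ofSpectrum hW]
  congr 1
  ext j
  exact hev _ (by simp [hS])

lemma exists_ofSpectrum {H : Matrix I I ℂ} (hH : H.IsHermitian) :
    ∃ W : Matrix I I ℂ, ∃ d : I → ℝ, IsUnitaryMat W ∧ H = ofSpectrum W d := by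
  refine ⟨hH.eigenvectorUnitary, hH.eigenvalues, ⟨?_, ?_⟩, ?_⟩
  · exact Unitary.coe_star_mul_self hH.eigenvectorUnitary
  · exact Unitary.coe_mul_star_self hH.eigenvectorUnitary
  · exact hH.spectral_theorem

lemma quad_ofSpectrum (V : Matrix I J ℂ) (d : J → ℝ) (C : Matrix I K ℂ) (i : K) :
    quad C (ofSpectrum V d) i = ∑ j, overlap V C j i * d j := by
  have h : Cᴴ * ofSpectrum V d * C = (Vᴴ * C)ᴴ * (diagonal (fun j => (d j : ℂ)) * (Vᴴ * C)) := by
    simp only [ofSpectrum, conjTranspose_mul, conjTranspose_conjTranspose, Matrix.mul_assoc]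
  unfold quad overlap
  rw [h, Matrix.mul_apply, Complex.re_sum]
  refine Finset.sum_congr rfl fun j _ => ?_
  rw [diagonal_mul, conjTranspose_apply]
  simp [Complex.normSq_apply]
  ring

lemma quad_ofSpectrum_self {V : Matrix I J ℂ} (hV : IsUnitaryMat V) (d : J → ℝ) (i : J) :
    quad V (ofSpectrum V d) i = d i := by
  rw [quad_ofSpectrum]
  simp [overlap, hV.1, Matrix.one_apply]

lemma sum_overlap_left {V : Matrix I J ℂ} (hV : IsUnitaryMat V) (C : Matrix I K ℂ) (i : K) :
    ∑ j, overlap V C j i = quad C 1 i := by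
  rw [← ofSpectrum_one hV, quad_ofSpectrum]
  simp

lemma quad_one {C : Matrix I K ℂ} (hC : IsUnitaryMat C) (i : K) : quad C 1 i = 1 := by
  simp [quad, hC.1]

lemma overlap_comm (V : Matrix I J ℂ) (C : Matrix I K ℂ) (j : J) (i : K) :
    overlap V C j i = overlap C V i j := by
  unfold overlap
  have : Cᴴ * V = (Vᴴ * C)ᴴ := by simp
  rw [this, conjTranspose_apply]
  simp

lemma trace_mul_ofSpectrum (M : Matrix I I ℂ) (W : Matrix I J ℂ) (d : J → ℝ) :
    (M * ofSpectrum W d).trace.re = ∑ j, d j * quad W M j := by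
  have h : (M * ofSpectrum W d).trace = (Wᴴ * M * W * diagonal (fun j => (d j : ℂ))).trace := by
    rw [ofSpectrum, ← Matrix.mul_assoc, Matrix.trace_mul_comm]
    simp only [Matrix.mul_assoc]
  rw [h, Matrix.trace, Complex.re_sum]
  refine Finset.sum_congr rfl fun j _ => ?_
  rw [Matrix.diag_apply, mul_diagonal, quad]
  simp [mul_comm]

lemma trace_ofSpectrum {W : Matrix I J ℂ} (hW : IsUnitaryMat W) (d : J → ℝ) :
    (ofSpectrum W d).trace.re = ∑ j, d j := by
  have := trace_mul_ofSpectrum 1 W d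
  simpa [quad_one hW] using this

lemma quad_trace {W : Matrix I J ℂ} (hW : IsUnitaryMat W) (M : Matrix I I ℂ) :
    ∑ j, quad W M j = M.trace.re := by
  have := trace_mul_ofSpectrum M W (fun _ => 1)
  rw [ofSpectrum_one hW] at this
  simpa using this.symm

lemma quad_nonneg {M : Matrix I I ℂ} (hM : M.PosSemidef) (C : Matrix I J ℂ) (i : J) :
    0 ≤ quad C M i := by
  have := (hM.conjTranspose_mul_mul_same C).diag_nonneg (i := i)
  exact (Complex.le_def.1 this).1

lemma quad_add (C : Matrix I J ℂ) (M N : Matrix I I ℂ) (i : J) :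
    quad C (M + N) i = quad C M i + quad C N i := by
  simp [quad, Matrix.mul_add, Matrix.add_mul]

lemma quad_sub (C : Matrix I J ℂ) (M N : Matrix I I ℂ) (i : J) :
    quad C (M - N) i = quad C M i - quad C N i := by
  simp [quad, Matrix.mul_sub, Matrix.sub_mul]

lemma quad_smul (C : Matrix I J ℂ) (c : ℝ) (M : Matrix I I ℂ) (i : J) :
    quad C (c • M) i = c * quad C M i := by
  simp [quad]

lemma quad_conj (C : Matrix I J ℂ) (D : Matrix I I ℂ) (M : Matrix I I ℂ) (i : J) :
    quad C (Dᴴ * M * D) i = quad (D * C) M i := by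
  simp [quad, Matrix.mul_assoc]

lemma exists_ofSpectrum_nonneg {H : Matrix I I ℂ} (hH : H.PosSemidef) :
    ∃ W : Matrix I I ℂ, ∃ d : I → ℝ, IsUnitaryMat W ∧ (∀ i, 0 ≤ d i) ∧ H = ofSpectrum W d := by
  obtain ⟨W, d, hW, rfl⟩ := exists_ofSpectrum hH.1
  refine ⟨W, d, hW, fun i => ?_, rfl⟩
  rw [← quad_ofSpectrum_self hW d i]
  exact quad_nonneg hH _ _

lemma ofSpectrum_posSemidef (W : Matrix I J ℂ) {d : J → ℝ} (hd : ∀ j, 0 ≤ d j) :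
    (ofSpectrum W d).PosSemidef := by
  refine Matrix.PosSemidef.mul_mul_conjTranspose_same ?_ W
  exact Matrix.PosSemidef.diagonal fun j => by simpa using hd j

/-- Peierls' inequality: the diagonal of a Hermitian matrix in an orthonormal basis is the image of
its eigenvalues under a doubly stochastic matrix. -/
lemma sum_convexOn_quad_le {V : Matrix I J ℂ} (hV : IsUnitaryMat V) {d : J → ℝ} {s : Set ℝ}
    {f : ℝ → ℝ} (hf : ConvexOn ℝ s f) (hd : ∀ j, d j ∈ s) {C : Matrix I K ℂ}
    (hC : IsUnitaryMat C) :
    ∑ i, f (quad C (ofSpectrum V d) i) ≤ ∑ j, f (d j) := by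
  have h1 : ∀ i, f (quad C (ofSpectrum V d) i) ≤ ∑ j, overlap V C j i * f (d j) := by
    intro i
    rw [quad_ofSpectrum]
    have := hf.map_sum_le (t := Finset.univ) (w := fun j => overlap V C j i) (p := d)
      (fun j _ => overlap_nonneg _ _ _ _) (by rw [sum_overlap_left hV, quad_one hC])
      (fun j _ => hd j)
    simpa [smul_eq_mul] using this
  calc _ ≤ ∑ i, ∑ j, overlap V C j i * f (d j) := Finset.sum_le_sum fun i _ => h1 i
    _ = ∑ j, (∑ i, overlap C V i j) * f (d j) := by
        rw [Finset.sum_comm]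
        simp only [overlap_comm V C, Finset.sum_mul]
    _ = _ := by simp only [sum_overlap_left hC, quad_one hV, one_mul]

/-- Matrices `B† B` and `B B†` have the same eigenvalues with multiplicity. -/
lemma sum_eigenvalues_comm {W V : Matrix I I ℂ} (hW : IsUnitaryMat W) (hV : IsUnitaryMat V)
    {d e : I → ℝ} {B : Matrix I I ℂ} (hd : Bᴴ * B = ofSpectrum W d)
    (he : B * Bᴴ = ofSpectrum V e) (f : ℝ → ℝ) : ∑ i, f (d i) = ∑ i, f (e i) := by
  have hc : ∀ {W : Matrix I I ℂ} (_ : IsUnitaryMat W) (d : I → ℝ),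
      (ofSpectrum W d).charpoly = ∏ i, (Polynomial.X - Polynomial.C (d i : ℂ)) := by
    intro W hW d
    rw [ofSpectrum, Matrix.charpoly_mul_comm, ← Matrix.mul_assoc, hW.1, Matrix.one_mul,
      charpoly_diagonal]
  have h : (ofSpectrum W d).charpoly = (ofSpectrum V e).charpoly := by
    rw [← hd, ← he, Matrix.charpoly_mul_comm]
  rw [hc hW, hc hV] at h
  have h2 := congrArg Polynomial.roots h
  rw [Polynomial.roots_prod _ _ (Finset.prod_ne_zero_iff.2 fun i _ => Polynomial.X_sub_C_ne_zero _),
    Polynomial.roots_prod _ _ (Finset.prod_ne_zero_iff.2 fun i _ => Polynomial.X_sub_C_ne_zero _)]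
    at h2
  simp only [Polynomial.roots_X_sub_C, Multiset.bind_singleton] at h2
  have h3 := congrArg (fun m => (m.map (fun z : ℂ => f z.re)).sum) h2
  simpa [Multiset.map_map, Function.comp_def] using h3

/-! ### Supports, powers and the Schatten norm in terms of eigenvalues -/

lemma powOnSupp_ofSpectrum {W : Matrix I J ℂ} (hW : IsUnitaryMat W) (d : J → ℝ) (p : ℝ) :
    powOnSupp (ofSpectrum W d) p = ofSpectrum W (fun j => d j ^ p) :=
  cfc_ofSpectrum hW d _

lemma logOnSupp_ofSpectrum {W : Matrix I J ℂ} (hW : IsUnitaryMat W) (d : J → ℝ) :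
    logOnSupp (ofSpectrum W d) = ofSpectrum W (fun j => Real.log (d j)) :=
  cfc_ofSpectrum hW d _

lemma supp_le_iff {γ σ : Matrix I I ℂ} : supp γ ≤ supp σ ↔ ∃ X, γ = σ * X := by
  constructor
  · intro h
    have h1 : ∀ j, ∃ v : I → ℂ, σ *ᵥ v = γ *ᵥ Pi.single j 1 := by
      intro j
      have : γ *ᵥ Pi.single j 1 ∈ supp σ := h ⟨Pi.single j 1, rfl⟩
      obtain ⟨v, hv⟩ := this
      exact ⟨v, hv⟩
    choose v hv using h1
    refine ⟨Matrix.of fun i j => v j i, ?_⟩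
    ext i j
    have := congrFun (hv j) i
    rw [mulVec_single_one, col_apply] at this
    rw [← this]
    rfl
  · rintro ⟨X, rfl⟩
    rintro _ ⟨v, rfl⟩
    exact ⟨X *ᵥ v, by simp⟩

/-- A Hermitian matrix supported in `supp σ` is recovered from its compression by `σ ^ (-c)`. -/
lemma conj_pow_conj_pow_neg {V : Matrix I I ℂ} (hV : IsUnitaryMat V) {s : I → ℝ}
    (hs : ∀ i, 0 ≤ s i) {γ : Matrix I I ℂ} (hγ : γ.IsHermitian)
    (h : supp γ ≤ supp (ofSpectrum V s)) (c : ℝ) :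
    ofSpectrum V (fun j => s j ^ c) *
      (ofSpectrum V (fun j => s j ^ (-c)) * γ * ofSpectrum V (fun j => s j ^ (-c))) *
      ofSpectrum V (fun j => s j ^ c) = γ := by
  obtain ⟨X, hX⟩ := supp_le_iff.1 h
  have hval : ∀ j, s j ^ c * s j ^ (-c) * s j = s j := by
    intro j
    rcases (hs j).eq_or_lt with h0 | h0
    · simp [← h0]
    · rw [← Real.rpow_add h0]; simp
  have h1 : ofSpectrum V (fun j => s j ^ c) * ofSpectrum V (fun j => s j ^ (-c)) * γ = γ := by
    conv_lhs => rw [hX]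
    rw [← Matrix.mul_assoc, ofSpectrum_mul hV, ofSpectrum_mul hV]
    simp only [hval]
    exact hX.symm
  have h2 : γ * ofSpectrum V (fun j => s j ^ (-c)) * ofSpectrum V (fun j => s j ^ c) = γ := by
    have := congrArg conjTranspose h1
    rw [conjTranspose_mul, conjTranspose_mul, (ofSpectrum_isHermitian V _).eq,
      (ofSpectrum_isHermitian V _).eq, hγ.eq, ← Matrix.mul_assoc] at this
    exact this
  calc _ = (ofSpectrum V (fun j => s j ^ c) * ofSpectrum V (fun j => s j ^ (-c)) * γ) *
        ofSpectrum V (fun j => s j ^ (-c)) * ofSpectrum V (fun j => s j ^ c) := by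
        simp only [Matrix.mul_assoc]
    _ = γ := by rw [h1, h2]

lemma isHermitian_conj {V : Matrix I J ℂ} {s : J → ℝ} {γ : Matrix I I ℂ} (hγ : γ.IsHermitian) :
    (ofSpectrum V s * γ * ofSpectrum V s).IsHermitian := by
  have := isHermitian_conjTranspose_mul_mul (ofSpectrum V s) hγ
  rwa [(ofSpectrum_isHermitian V s).eq] at this

lemma schattenNorm_ofSpectrum {U : Matrix I J ℂ} (hU : IsUnitaryMat U) (y : J → ℝ) (α : ℝ) :
    schattenNorm α (ofSpectrum U y) = (∑ i, |y i| ^ α) ^ (1 / α) := by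
  unfold schattenNorm
  rw [(ofSpectrum_isHermitian U y).eq, ofSpectrum_mul hU, powOnSupp_ofSpectrum hU,
    trace_ofSpectrum hU]
  congr 1
  refine Finset.sum_congr rfl fun i _ => ?_
  rw [← abs_mul_abs_self, ← pow_two, ← Real.rpow_natCast, ← Real.rpow_mul (abs_nonneg _)]
  congr 1
  push_cast
  ring

/-! ### Hölder's inequality for a test -/

/-- Jensen's inequality for a power and weights of total mass at most one. -/
lemma rpow_sum_mul_le {w x : J → ℝ} (hw : ∀ j, 0 ≤ w j) (hw1 : ∑ j, w j ≤ 1)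
    (hx : ∀ j, 0 ≤ x j) {β : ℝ} (hβ : 1 ≤ β) :
    (∑ j, w j * x j) ^ β ≤ ∑ j, w j * x j ^ β := by
  have := (convexOn_rpow hβ).map_add_sum_le (t := Finset.univ) (w := w) (p := x)
    (v := 1 - ∑ j, w j) (q := 0) (fun j _ => hw j) (by simp) (fun j _ => hx j)
    (by linarith) (by simp)
  simpa [Real.zero_rpow (by linarith : β ≠ 0)] using this

/-- The special case `Tr (σ^(1/2β) Λ σ^(1/2β))^β ≤ Tr Λ σ` of the Araki–Lieb–Thirring inequality for
a test `0 ≤ Λ ≤ 1`. After passing from `B† B` to `B B†` with `B = Λ^(1/2) σ^(1/2β)`, it is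
Jensen's inequality for the contraction `Λ^(1/2)`. -/
lemma sum_quad_rpow_le {σ Λ : Matrix I I ℂ} (hΛ : Λ.PosSemidef) (hΛ1 : (1 - Λ).PosSemidef)
    {V : Matrix I I ℂ} (hV : IsUnitaryMat V) {s : I → ℝ} (hs : ∀ i, 0 ≤ s i)
    (hσ : σ = ofSpectrum V s) {β c : ℝ} (hβ : 1 ≤ β) (hc : (c + c) * β = 1)
    {U : Matrix I I ℂ} (hU : IsUnitaryMat U) :
    ∑ i, (quad U (ofSpectrum V (fun j => s j ^ c) * Λ * ofSpectrum V (fun j => s j ^ c)) i) ^ β ≤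
      (Λ * σ).trace.re := by
  obtain ⟨Q, l, hQ, hl, hΛQ⟩ := exists_ofSpectrum_nonneg hΛ
  set C := ofSpectrum Q (fun j => √(l j)) with hC
  have hCC : C * C = Λ := by
    rw [hC, ofSpectrum_mul hQ, hΛQ]
    congr 1
    ext j
    exact Real.mul_self_sqrt (hl j)
  have hCh : Cᴴ = C := (ofSpectrum_isHermitian _ _).eq
  set S := ofSpectrum V (fun j => s j ^ c) with hS
  have hSh : Sᴴ = S := (ofSpectrum_isHermitian _ _).eq
  have hB : (C * S)ᴴ * (C * S) = S * Λ * S := by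
    rw [conjTranspose_mul, hCh, hSh, ← hCC]; simp only [Matrix.mul_assoc]
  have hSS : S * S = ofSpectrum V (fun j => s j ^ (c + c)) := by
    rw [hS, ofSpectrum_mul hV]
    congr 1
    ext j
    rw [Real.rpow_add' (hs j)]
    intro h0
    rw [h0] at hc
    simp at hc
  have hB' : (C * S) * (C * S)ᴴ = Cᴴ * ofSpectrum V (fun j => s j ^ (c + c)) * C := by
    rw [conjTranspose_mul, hCh, hSh, ← hSS]; simp only [Matrix.mul_assoc]
  obtain ⟨W, d, hW, hd, hWd⟩ := exists_ofSpectrum_nonneg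
    (Matrix.posSemidef_conjTranspose_mul_self (C * S))
  obtain ⟨T, e, hT, he, hTe⟩ := exists_ofSpectrum_nonneg
    (Matrix.posSemidef_self_mul_conjTranspose (C * S))
  calc _ ≤ ∑ i, d i ^ β := by
        rw [← hB, hWd]
        exact sum_convexOn_quad_le hW (convexOn_rpow hβ) (fun j => hd j) hU
    _ = ∑ i, e i ^ β := sum_eigenvalues_comm hW hT hWd hTe (fun t => t ^ β)
    _ ≤ ∑ i, quad (C * T) σ i := by
        refine Finset.sum_le_sum fun i _ => ?_
        rw [← quad_ofSpectrum_self hT e i, ← hTe, hB', quad_conj, quad_ofSpectrum, hσ,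
          quad_ofSpectrum]
        refine (rpow_sum_mul_le (fun j => overlap_nonneg _ _ _ _) ?_
          (fun j => Real.rpow_nonneg (hs j) _) hβ).trans (le_of_eq ?_)
        · rw [sum_overlap_left hV, ← quad_conj, hCh, Matrix.mul_one, hCC]
          have := quad_nonneg hΛ1 T i
          rw [quad_sub, quad_one hT] at this
          linarith
        · refine Finset.sum_congr rfl fun j _ => ?_
          rw [← Real.rpow_mul (hs j), hc, Real.rpow_one]
    _ = (Λ * σ).trace.re := by
        simp only [← quad_conj]
        rw [quad_trace hT, hCh, Matrix.mul_assoc, Matrix.trace_mul_comm, Matrix.mul_assoc, hCC,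
          Matrix.trace_mul_comm]

/-- The operator `σ^((1-α)/2α) γ σ^((1-α)/2α)` whose norm defines the sandwiched divergence. -/
noncomputable def sandwich (α : ℝ) (γ σ : Matrix I I ℂ) : Matrix I I ℂ :=
  powOnSupp σ ((1 - α) / (2 * α)) * γ * powOnSupp σ ((1 - α) / (2 * α))

lemma sandwich_isHermitian (α : ℝ) {γ σ : Matrix I I ℂ} (hγ : γ.IsHermitian)
    (hσ : σ.PosSemidef) : (sandwich α γ σ).IsHermitian := by
  obtain ⟨V, s, hV, hs, rfl⟩ := exists_ofSpectrum_nonneg hσ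
  rw [sandwich, powOnSupp_ofSpectrum hV]
  exact isHermitian_conj hγ

/-- The probability of a test on `γ` is controlled by its probability on `σ` and the sandwiched
norm of `γ`. -/
lemma abs_trace_mul_le {α : ℝ} (hα : 1 < α) {γ σ Λ : Matrix I I ℂ} (hγ : γ.IsHermitian)
    (hσ : σ.PosSemidef) (h : supp γ ≤ supp σ) (hΛ : Λ.PosSemidef) (hΛ1 : (1 - Λ).PosSemidef) :
    |(Λ * γ).trace.re| ≤
      schattenNorm α (sandwich α γ σ) * (Λ * σ).trace.re ^ ((α - 1) / α) := by
  have hY := sandwich_isHermitian α hγ hσ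
  obtain ⟨V, s, hV, hs, hσV⟩ := exists_ofSpectrum_nonneg hσ
  obtain ⟨U, y, hU, hYU⟩ := exists_ofSpectrum hY
  set c : ℝ := (α - 1) / (2 * α) with hc
  have hα0 : 0 < α := by linarith
  have hα1 : 0 < α - 1 := by linarith
  have hcβ : (c + c) * (α / (α - 1)) = 1 := by rw [hc]; field_simp; norm_num
  set S := ofSpectrum V (fun j => s j ^ c) with hS
  have hSYS : S * ofSpectrum U y * S = γ := by
    rw [← hYU, sandwich, hσV, powOnSupp_ofSpectrum hV,
      show (1 - α) / (2 * α) = -c by rw [hc]; ring]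
    exact conj_pow_conj_pow_neg hV hs hγ (hσV ▸ h) c
  have htr : (Λ * γ).trace.re = ∑ i, y i * quad U (S * Λ * S) i := by
    rw [← trace_mul_ofSpectrum, ← hSYS, ← Matrix.mul_assoc, Matrix.trace_mul_comm]
    simp only [Matrix.mul_assoc]
  have hz : ∀ i, 0 ≤ quad U (S * Λ * S) i := by
    intro i
    have := hΛ.conjTranspose_mul_mul_same S
    rw [(ofSpectrum_isHermitian V _).eq] at this
    exact quad_nonneg this _ _
  have hconj : α.HolderConjugate (α / (α - 1)) := Real.HolderConjugate.conjExponent hα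
  have hkey := sum_quad_rpow_le hΛ hΛ1 hV hs hσV
    (by rw [le_div_iff₀ hα1]; linarith : 1 ≤ α / (α - 1)) hcβ hU
  calc |(Λ * γ).trace.re| ≤ ∑ i, |y i| * quad U (S * Λ * S) i := by
        rw [htr]
        refine (Finset.abs_sum_le_sum_abs _ _).trans (le_of_eq ?_)
        refine Finset.sum_congr rfl fun i _ => ?_
        rw [abs_mul, abs_of_nonneg (hz i)]
    _ ≤ (∑ i, |y i| ^ α) ^ (1 / α) *
        (∑ i, quad U (S * Λ * S) i ^ (α / (α - 1))) ^ (1 / (α / (α - 1))) :=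
        Real.inner_le_Lp_mul_Lq_of_nonneg _ hconj (fun i _ => abs_nonneg _) (fun i _ => hz i)
    _ ≤ _ := by
        rw [hYU, schattenNorm_ofSpectrum hU, one_div_div]
        gcongr
        exact Finset.sum_nonneg fun i _ => Real.rpow_nonneg (hz i) _

/-- The value of the sandwiched divergence when the support condition holds. -/
noncomputable def renyiReal (α : ℝ) (γ σ : Matrix I I ℂ) : ℝ :=
  1 / (α - 1) * Real.log (schattenNorm α (sandwich α γ σ) ^ α)

lemma sandwichedRenyi_of_le {α : ℝ} {γ σ : Matrix I I ℂ} (h : supp γ ≤ supp σ) :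
    sandwichedRenyi α γ σ = (renyiReal α γ σ : EReal) := by
  rw [sandwichedRenyi, if_pos h]
  rfl

lemma sandwichedRenyi_of_not_le {α : ℝ} {γ σ : Matrix I I ℂ} (h : ¬ supp γ ≤ supp σ) :
    sandwichedRenyi α γ σ = ⊤ := by
  rw [sandwichedRenyi, if_neg h]

lemma one_le_schattenNorm_sandwich {α : ℝ} (hα : 1 < α) {γ σ : Matrix I I ℂ}
    (hγ : γ ∈ affStates I) (hσ : IsState σ) (h : supp γ ≤ supp σ) :
    1 ≤ schattenNorm α (sandwich α γ σ) := by
  have := abs_trace_mul_le hα hγ.1 hσ.1 h Matrix.PosSemidef.one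
    (by simpa using Matrix.PosSemidef.zero)
  simpa [hγ.2, hσ.2] using this

lemma renyiReal_nonneg {α : ℝ} (hα : 1 < α) {γ σ : Matrix I I ℂ}
    (hγ : γ ∈ affStates I) (hσ : IsState σ) (h : supp γ ≤ supp σ) :
    0 ≤ renyiReal α γ σ := by
  have h1 := one_le_schattenNorm_sandwich hα hγ hσ h
  have : 0 ≤ 1 / (α - 1) := by
    have : 0 < α - 1 := by linarith
    positivity
  exact mul_nonneg this (Real.log_nonneg (Real.one_le_rpow h1 (by linarith)))

/-- A test with `|Tr Λ γ| ≥ t` accepts `σ` with probability at least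
`t^(α/(α-1)) exp(-D_α(γ‖σ))`. -/
lemma rpow_mul_exp_le_trace {α : ℝ} (hα : 1 < α) {γ σ Λ : Matrix I I ℂ}
    (hγ : γ ∈ affStates I) (hσ : IsState σ) (h : supp γ ≤ supp σ) (hΛ : Λ.PosSemidef)
    (hΛ1 : (1 - Λ).PosSemidef) {t : ℝ} (ht : 0 ≤ t) (htr : t ≤ |(Λ * γ).trace.re|) :
    t ^ (α / (α - 1)) * Real.exp (-renyiReal α γ σ) ≤ (Λ * σ).trace.re := by
  have hα0 : 0 < α := by linarith
  have hα1 : 0 < α - 1 := by linarith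
  have hN := one_le_schattenNorm_sandwich hα hγ hσ h
  set N := schattenNorm α (sandwich α γ σ) with hNdef
  have hN0 : 0 < N := by linarith
  have ha : 0 ≤ (Λ * σ).trace.re := by
    obtain ⟨V, s, hV, hs, rfl⟩ := exists_ofSpectrum_nonneg hσ.1
    rw [trace_mul_ofSpectrum]
    exact Finset.sum_nonneg fun i _ => mul_nonneg (hs i) (quad_nonneg hΛ _ _)
  have h1 := htr.trans (abs_trace_mul_le hα hγ.1 hσ.1 h hΛ hΛ1)
  rw [← hNdef] at h1
  have h2 := Real.rpow_le_rpow ht h1 (by positivity : 0 ≤ α / (α - 1))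
  rw [Real.mul_rpow hN0.le (by positivity), ← Real.rpow_mul ha,
    show (α - 1) / α * (α / (α - 1)) = 1 by field_simp, Real.rpow_one] at h2
  have h3 : Real.exp (-renyiReal α γ σ) = (N ^ (α / (α - 1)))⁻¹ := by
    rw [Real.rpow_def_of_pos hN0, ← Real.exp_neg, renyiReal, ← hNdef, Real.log_rpow hN0]
    congr 1
    field_simp
  rw [h3, ← div_eq_mul_inv, div_le_iff₀ (by positivity), mul_comm]
  exact h2

/-! ### Tensor products -/

/-- The tensor product of operators on the factors of a composite system, whose product basis is
indexed through an equivalence `e`. -/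
def tens (e : K ≃ I × J) (M : Matrix I I ℂ) (N : Matrix J J ℂ) : Matrix K K ℂ :=
  (M ⊗ₖ N).submatrix e e

variable (e : K ≃ I × J)

lemma tens_mul (M M' : Matrix I I ℂ) (N N' : Matrix J J ℂ) :
    tens e M N * tens e M' N' = tens e (M * M') (N * N') := by
  rw [tens, tens, submatrix_mul_equiv, ← mul_kronecker_mul, tens]

lemma tens_conjTranspose (M : Matrix I I ℂ) (N : Matrix J J ℂ) :
    (tens e M N)ᴴ = tens e Mᴴ Nᴴ := by
  rw [tens, conjTranspose_submatrix, conjTranspose_kronecker, tens]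

lemma tens_one_one : tens e (1 : Matrix I I ℂ) (1 : Matrix J J ℂ) = 1 := by
  rw [tens, one_kronecker_one, submatrix_one_equiv]

lemma trace_tens (M : Matrix I I ℂ) (N : Matrix J J ℂ) :
    (tens e M N).trace = M.trace * N.trace := by
  rw [← trace_kronecker, tens]
  simp only [Matrix.trace, Matrix.diag_apply, submatrix_apply]
  exact Equiv.sum_comp e (fun p => (M ⊗ₖ N) p p)

lemma tens_posSemidef {M : Matrix I I ℂ} {N : Matrix J J ℂ} (hM : M.PosSemidef)
    (hN : N.PosSemidef) : (tens e M N).PosSemidef :=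
  (hM.kronecker hN).submatrix e

lemma tens_isHermitian {M : Matrix I I ℂ} {N : Matrix J J ℂ} (hM : M.IsHermitian)
    (hN : N.IsHermitian) : (tens e M N).IsHermitian := by
  rw [Matrix.IsHermitian, tens_conjTranspose, hM.eq, hN.eq]

lemma isUnitaryMat_kronecker {V : Matrix I I ℂ} {W : Matrix J J ℂ} (hV : IsUnitaryMat V)
    (hW : IsUnitaryMat W) : IsUnitaryMat ((V ⊗ₖ W).submatrix e id) := by
  constructor
  · rw [conjTranspose_submatrix, conjTranspose_kronecker, submatrix_mul_equiv,
      ← mul_kronecker_mul, hV.1, hW.1, one_kronecker_one, submatrix_id_id]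
  · rw [conjTranspose_submatrix, conjTranspose_kronecker,
      ← submatrix_mul _ _ e id e Function.bijective_id,
      ← mul_kronecker_mul, hV.2, hW.2, one_kronecker_one, submatrix_one_equiv]

lemma tens_ofSpectrum (V : Matrix I I ℂ) (W : Matrix J J ℂ) (s : I → ℝ) (t : J → ℝ) :
    tens e (ofSpectrum V s) (ofSpectrum W t) =
      ofSpectrum ((V ⊗ₖ W).submatrix e id) (fun q => s q.1 * t q.2) := by
  rw [tens, ofSpectrum, ofSpectrum, ofSpectrum, mul_kronecker_mul, mul_kronecker_mul,
    diagonal_kronecker_diagonal, conjTranspose_submatrix, conjTranspose_kronecker,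
    submatrix_mul _ _ e id e Function.bijective_id, submatrix_mul _ _ e id id Function.bijective_id,
    submatrix_id_id]
  simp

lemma powOnSupp_tens {M : Matrix I I ℂ} {N : Matrix J J ℂ} (hM : M.PosSemidef)
    (hN : N.PosSemidef) (p : ℝ) :
    powOnSupp (tens e M N) p = tens e (powOnSupp M p) (powOnSupp N p) := by
  obtain ⟨V, s, hV, hs, rfl⟩ := exists_ofSpectrum_nonneg hM
  obtain ⟨W, t, hW, ht, rfl⟩ := exists_ofSpectrum_nonneg hN
  rw [tens_ofSpectrum, powOnSupp_ofSpectrum (isUnitaryMat_kronecker e hV hW),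
    powOnSupp_ofSpectrum hV, powOnSupp_ofSpectrum hW, tens_ofSpectrum]
  congr 1
  ext q
  exact Real.mul_rpow (hs _) (ht _)

lemma supp_tens_le {γ σ : Matrix I I ℂ} {γ' σ' : Matrix J J ℂ} (h : supp γ ≤ supp σ)
    (h' : supp γ' ≤ supp σ') : supp (tens e γ γ') ≤ supp (tens e σ σ') := by
  obtain ⟨X, rfl⟩ := supp_le_iff.1 h
  obtain ⟨X', rfl⟩ := supp_le_iff.1 h'
  exact supp_le_iff.2 ⟨tens e X X', (tens_mul e _ _ _ _).symm⟩

lemma schattenNorm_tens (α : ℝ) {M : Matrix I I ℂ} {N : Matrix J J ℂ} (hM : M.IsHermitian)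
    (hN : N.IsHermitian) :
    schattenNorm α (tens e M N) = schattenNorm α M * schattenNorm α N := by
  obtain ⟨V, s, hV, rfl⟩ := exists_ofSpectrum hM
  obtain ⟨W, t, hW, rfl⟩ := exists_ofSpectrum hN
  rw [tens_ofSpectrum, schattenNorm_ofSpectrum (isUnitaryMat_kronecker e hV hW),
    schattenNorm_ofSpectrum hV, schattenNorm_ofSpectrum hW, ← Real.mul_rpow (by positivity)
    (by positivity), Fintype.sum_prod_type, Finset.sum_mul_sum]
  simp only [abs_mul, Real.mul_rpow (abs_nonneg _) (abs_nonneg _)]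

lemma sandwich_tens (α : ℝ) (γ : Matrix I I ℂ) (γ' : Matrix J J ℂ) {σ : Matrix I I ℂ}
    {σ' : Matrix J J ℂ} (hσ : σ.PosSemidef) (hσ' : σ'.PosSemidef) :
    sandwich α (tens e γ γ') (tens e σ σ') = tens e (sandwich α γ σ) (sandwich α γ' σ') := by
  simp only [sandwich, powOnSupp_tens e hσ hσ', tens_mul]

lemma affStates_tens {γ : Matrix I I ℂ} {γ' : Matrix J J ℂ} (hγ : γ ∈ affStates I)
    (hγ' : γ' ∈ affStates J) : tens e γ γ' ∈ affStates K :=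
  ⟨tens_isHermitian e hγ.1 hγ'.1, by rw [trace_tens, hγ.2, hγ'.2, one_mul]⟩

lemma isState_tens {γ : Matrix I I ℂ} {γ' : Matrix J J ℂ} (hγ : IsState γ)
    (hγ' : IsState γ') : IsState (tens e γ γ') :=
  ⟨tens_posSemidef e hγ.1 hγ'.1, by rw [trace_tens, hγ.2, hγ'.2, one_mul]⟩

/-- The sandwiched divergence is additive under tensor products. -/
lemma renyiReal_tens {α : ℝ} (hα : 1 < α) {γ σ : Matrix I I ℂ} {γ' σ' : Matrix J J ℂ}
    (hγ : γ ∈ affStates I) (hγ' : γ' ∈ affStates J) (hσ : IsState σ) (hσ' : IsState σ')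
    (h : supp γ ≤ supp σ) (h' : supp γ' ≤ supp σ') :
    renyiReal α (tens e γ γ') (tens e σ σ') = renyiReal α γ σ + renyiReal α γ' σ' := by
  have h1 := one_le_schattenNorm_sandwich hα hγ hσ h
  have h2 := one_le_schattenNorm_sandwich hα hγ' hσ' h'
  rw [renyiReal, sandwich_tens e α γ γ' hσ.1 hσ'.1,
    schattenNorm_tens e α (sandwich_isHermitian α hγ.1 hσ.1) (sandwich_isHermitian α hγ'.1 hσ'.1),
    Real.mul_rpow (by linarith) (by linarith), Real.log_mul (by positivity) (by positivity),
    mul_add]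
  rfl

lemma renyiReal_one {α : ℝ} [Unique I] : renyiReal α (1 : Matrix I I ℂ) 1 = 0 := by
  have h1 : (1 : Matrix I I ℂ) = ofSpectrum 1 (fun _ => 1) :=
    (ofSpectrum_one isUnitaryMat_one).symm
  have h2 : ∀ p : ℝ, powOnSupp (1 : Matrix I I ℂ) p = 1 := by
    intro p
    rw [h1, powOnSupp_ofSpectrum isUnitaryMat_one]
    simp
  have h3 : schattenNorm α (1 : Matrix I I ℂ) = 1 := by
    rw [h1, schattenNorm_ofSpectrum isUnitaryMat_one]
    simp
  rw [renyiReal, sandwich, h2]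
  simp [h3]

variable {A : Type*} [Fintype A] [DecidableEq A]

lemma tensorPow_add (m n : ℕ) (M : Matrix A A ℂ) :
    tensorPow (m + n) M = tens (Fin.appendEquiv m n).symm (tensorPow m M) (tensorPow n M) := by
  ext i j
  simp [tens, tensorPow, Fin.prod_univ_add, Fin.appendEquiv]

lemma tensorPow_zero (M : Matrix A A ℂ) : tensorPow 0 M = 1 := by
  ext i j
  simp [tensorPow, Matrix.one_apply, Subsingleton.elim i j]

lemma tensorPow_one (M : Matrix A A ℂ) :
    tensorPow 1 M = tens ((Equiv.funUnique (Fin 1) A).trans (Equiv.prodPUnit A).symm)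
      M (1 : Matrix Unit Unit ℂ) := by
  ext i j
  simp [tens, tensorPow]

lemma isState_one_of_unique [Unique I] : IsState (1 : Matrix I I ℂ) :=
  ⟨Matrix.PosSemidef.one, by simp⟩

lemma isState_tensorPow {ρ : Matrix A A ℂ} (hρ : IsState ρ) (n : ℕ) :
    IsState (tensorPow n ρ) := by
  induction n with
  | zero => rw [tensorPow_zero]; exact isState_one_of_unique
  | succ n ih =>
    rw [tensorPow_add, tensorPow_one]
    exact isState_tens _ ih (isState_tens _ hρ isState_one_of_unique)

lemma IsState.mem_affStates {ρ : Matrix I I ℂ} (hρ : IsState ρ) : ρ ∈ affStates I :=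
  ⟨hρ.1.1, hρ.2⟩

end Matrices

/-! ### Separation from an orthant -/

section Separation

variable {ι : Type*} [Fintype ι] [Nonempty ι]

/-- A finite-dimensional minimax principle: if every vector of a convex set has a coordinate at
least `v`, then some probability distribution has mean at least `v` on the whole set. -/
lemma exists_stdSimplex_of_convex {S : Set (ι → ℝ)} (hS : Convex ℝ S) {v : ℝ}
    (h : ∀ d ∈ S, ∃ x, v ≤ d x) : ∃ s ∈ stdSimplex ℝ ι, ∀ d ∈ S, v ≤ ∑ x, s x * d x := by
  classical
  rcases S.eq_empty_or_nonempty with rfl | ⟨d₀, hd₀⟩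
  · obtain ⟨x⟩ := ‹Nonempty ι›
    exact ⟨Pi.single x 1, single_mem_stdSimplex ℝ x, by simp⟩
  set C : Set (ι → ℝ) := {d | ∀ x, d x < v} with hC
  have hCo : IsOpen C := by
    rw [hC, Set.ofPred_forall]
    exact isOpen_iInter_of_finite fun x => isOpen_lt (continuous_apply x) continuous_const
  have hCc : Convex ℝ C := by
    intro a ha b hb p q hp hq hpq x
    have h1 := ha x
    have h2 := hb x
    simp only [Pi.add_apply, Pi.smul_apply, smul_eq_mul]
    rcases hp.eq_or_lt with rfl | hp
    · have : q = 1 := by linarith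
      subst this
      linarith
    · have hv : v = p * v + q * v := by rw [← add_mul, hpq, one_mul]
      have := mul_lt_mul_of_pos_left h1 hp
      have := mul_le_mul_of_nonneg_left h2.le hq
      linarith
  have hdis : Disjoint C S := by
    rw [Set.disjoint_left]
    intro d hd hdS
    obtain ⟨x, hx⟩ := h d hdS
    exact absurd (hd x) (not_lt.2 hx)
  obtain ⟨f, u, hfC, hfS⟩ := geometric_hahn_banach_open hCc hCo hS hdis
  set c : ι → ℝ := fun x => f (Pi.single x 1) with hc
  have hf : ∀ d, f d = ∑ x, c x * d x := by
    intro d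
    conv_lhs => rw [← Finset.univ_sum_single d]
    rw [map_sum]
    refine Finset.sum_congr rfl fun x _ => ?_
    have : Pi.single x (d x) = d x • (Pi.single x 1 : ι → ℝ) := by
      rw [← Pi.single_smul]; simp
    rw [this, map_smul, smul_eq_mul, mul_comm]
  have hc0 : ∀ x, 0 ≤ c x := by
    intro x
    by_contra! hx
    -- Moving to infinity along `-eₓ` inside the orthant, `f` would exceed `u`.
    set a : ι → ℝ := fun _ => v - 1 with ha
    set t : ℝ := max 0 ((u - f a) / (-c x)) with ht
    have ht0 : 0 ≤ t := le_max_left _ _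
    have hmem : a - t • (Pi.single x 1 : ι → ℝ) ∈ C := by
      intro y
      have : 0 ≤ (Pi.single x 1 : ι → ℝ) y := by
        by_cases hy : y = x
        · subst hy; simp
        · simp [hy]
      simp only [Pi.sub_apply, Pi.smul_apply, smul_eq_mul, ha]
      nlinarith [mul_nonneg ht0 this]
    have h1 := hfC _ hmem
    rw [map_sub, map_smul, smul_eq_mul] at h1
    have h2 : (u - f a) / (-c x) ≤ t := le_max_right _ _
    rw [div_le_iff₀ (by linarith)] at h2
    change f a - t * c x < u at h1
    linarith
  have hsum : 0 < ∑ x, c x := by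
    refine lt_of_le_of_ne (Finset.sum_nonneg fun x _ => hc0 x) fun h0 => ?_
    have hz : ∀ x, c x = 0 := fun x =>
      (Finset.sum_eq_zero_iff_of_nonneg fun x _ => hc0 x).1 h0.symm x (Finset.mem_univ _)
    have h1 := hfC (fun _ => v - 1) (fun _ => by linarith)
    have h2 := hfS d₀ hd₀
    rw [hf] at h1 h2
    simp [hz] at h1 h2
    linarith
  have hvu : v * ∑ x, c x ≤ u := by
    refine le_of_forall_pos_lt_add fun ε hε => ?_
    have h1 := hfC (fun _ => v - ε / ∑ x, c x) (fun _ => by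
      have : 0 < ε / ∑ x, c x := by positivity
      linarith)
    rw [hf, ← Finset.sum_mul] at h1
    have : (∑ x, c x) * (v - ε / ∑ x, c x) = v * (∑ x, c x) - ε := by field_simp
    linarith
  refine ⟨fun x => c x / ∑ x, c x, ⟨fun x => div_nonneg (hc0 x) hsum.le, ?_⟩, fun d hd => ?_⟩
  · rw [← Finset.sum_div, div_self hsum.ne']
  · have h1 := hfS d hd
    rw [hf] at h1
    have : ∑ x, c x / (∑ x, c x) * d x = (∑ x, c x * d x) / ∑ x, c x := by
      rw [Finset.sum_div]
      exact Finset.sum_congr rfl fun x _ => by ring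
    rw [this, le_div_iff₀ hsum]
    linarith

/-- The minimax principle for an additive semigroup in place of a convex set: the closure of the
positive rational multiples of its elements is a convex cone. -/
lemma exists_stdSimplex_of_add_mem {G : Set (ι → ℝ)} (hadd : ∀ g ∈ G, ∀ h ∈ G, g + h ∈ G)
    (h : ∀ g ∈ G, ∃ x, 0 ≤ g x) : ∃ s ∈ stdSimplex ℝ ι, ∀ g ∈ G, 0 ≤ ∑ x, s x * g x := by
  have hnsmul : ∀ k : ℕ, 0 < k → ∀ g ∈ G, (k : ℝ) • g ∈ G := by
    intro k hk g hg
    induction k, hk using Nat.le_induction with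
    | base => simpa using hg
    | succ k _ ih =>
      push_cast
      rw [add_smul, one_smul]
      exact hadd _ ih _ hg
  set Q : Set (ι → ℝ) := {z | ∃ k : ℕ, 0 < k ∧ (k : ℝ) • z ∈ G} with hQ
  set R : Set ℝ := {t | ∃ a b : ℕ, 0 < a ∧ 0 < b ∧ t = (a : ℝ) / b} with hR
  have hQadd : ∀ z ∈ Q, ∀ w ∈ Q, z + w ∈ Q := by
    rintro z ⟨k, hk, hz⟩ w ⟨l, hl, hw⟩
    refine ⟨k * l, Nat.mul_pos hk hl, ?_⟩
    have := hadd _ (hnsmul l hl _ hz) _ (hnsmul k hk _ hw)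
    rw [smul_smul, smul_smul] at this
    rw [smul_add]
    push_cast
    rwa [mul_comm (k : ℝ) l, mul_comm (l : ℝ) k] at *
  have hQsmul : ∀ t ∈ R, ∀ z ∈ Q, t • z ∈ Q := by
    rintro t ⟨a, b, ha, hb, rfl⟩ z ⟨k, hk, hz⟩
    refine ⟨b * k, Nat.mul_pos hb hk, ?_⟩
    have hb' : (b : ℝ) ≠ 0 := by positivity
    have := hnsmul a ha _ hz
    rw [smul_smul] at this ⊢
    convert this using 2
    push_cast
    field_simp
  have hRdense : ∀ t : ℝ, 0 ≤ t → t ∈ closure R := by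
    intro t ht
    rw [Metric.mem_closure_iff]
    intro ε hε
    obtain ⟨q, hq1, hq2⟩ := exists_rat_btwn (show t < t + ε by linarith)
    have hq0 : (0 : ℚ) < q := by
      have : (0 : ℝ) < q := by linarith
      exact_mod_cast this
    refine ⟨q, ⟨q.num.toNat, q.den, ?_, q.den_pos, ?_⟩, ?_⟩
    · have := Rat.num_pos.2 hq0
      omega
    · have h1 : ((q.num.toNat : ℤ)) = q.num := Int.toNat_of_nonneg (Rat.num_pos.2 hq0).le
      have h2 : ((q.num.toNat : ℕ) : ℝ) = (q.num : ℝ) := by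
        exact_mod_cast congrArg (Int.cast (R := ℝ)) h1
      rw [h2]
      exact_mod_cast (Rat.num_div_den q).symm
    · rw [Real.dist_eq, abs_sub_lt_iff]
      constructor <;> linarith
  have hcsmul : ∀ t : ℝ, 0 ≤ t → ∀ z ∈ closure Q, t • z ∈ closure Q := fun t ht z hz =>
    map_mem_closure₂ continuous_smul (hRdense t ht) hz hQsmul
  have hcadd : ∀ z ∈ closure Q, ∀ w ∈ closure Q, z + w ∈ closure Q := fun z hz w hw =>
    map_mem_closure₂ continuous_add hz hw hQadd
  have hconv : Convex ℝ (closure Q) := fun z hz w hw a b ha hb _ =>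
    hcadd _ (hcsmul a ha z hz) _ (hcsmul b hb w hw)
  have hclosed : IsClosed {z : ι → ℝ | ∃ x, 0 ≤ z x} := by
    rw [Set.ofPred_exists]
    exact isClosed_iUnion_of_finite fun x => isClosed_le continuous_const (continuous_apply x)
  have hsub : closure Q ⊆ {z : ι → ℝ | ∃ x, 0 ≤ z x} := by
    refine closure_minimal ?_ hclosed
    rintro z ⟨k, hk, hz⟩
    obtain ⟨x, hx⟩ := h _ hz
    refine ⟨x, ?_⟩
    have hk' : (0 : ℝ) < k := by exact_mod_cast hk
    exact nonneg_of_mul_nonneg_right hx hk'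
  obtain ⟨s, hs, hsQ⟩ := exists_stdSimplex_of_convex hconv (v := 0) fun d hd => hsub hd
  exact ⟨s, hs, fun g hg => hsQ g (subset_closure ⟨1, one_pos, by simpa using hg⟩)⟩

end Separation

/-! ### The semigroup of attainable divergence vectors -/

section Rates

variable {A : Type*} [Fintype A] [DecidableEq A] {r : ℕ}

/-- `AttainsRates α ρ n d` means that some Hermitian operator of trace one on `n` copies of the
system has the finite sandwiched divergences `d x` from the states `ρₓ^{⊗ n}`. -/
def AttainsRates (α : ℝ) (ρ : Fin r → Matrix A A ℂ) (n : ℕ) (d : Fin r → ℝ) : Prop :=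
  ∃ τ ∈ affStates (Fin n → A), ∀ x, supp τ ≤ supp (tensorPow n (ρ x)) ∧
    renyiReal α τ (tensorPow n (ρ x)) = d x

variable {ρ : Fin r → Matrix A A ℂ} {α : ℝ}

lemma AttainsRates.add (hα : 1 < α) (hρ : ∀ x, IsState (ρ x)) {m n : ℕ} {d d' : Fin r → ℝ}
    (h : AttainsRates α ρ m d) (h' : AttainsRates α ρ n d') :
    AttainsRates α ρ (m + n) (d + d') := by
  obtain ⟨τ, hτ, hd⟩ := h
  obtain ⟨τ', hτ', hd'⟩ := h'
  refine ⟨_, affStates_tens (Fin.appendEquiv m n).symm hτ hτ', fun x => ?_⟩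
  rw [tensorPow_add]
  refine ⟨supp_tens_le _ (hd x).1 (hd' x).1, ?_⟩
  rw [renyiReal_tens _ hα hτ hτ' (isState_tensorPow (hρ x) m) (isState_tensorPow (hρ x) n)
    (hd x).1 (hd' x).1, (hd x).2, (hd' x).2, Pi.add_apply]

lemma AttainsRates.nsmul (hα : 1 < α) (hρ : ∀ x, IsState (ρ x)) {n : ℕ} {d : Fin r → ℝ}
    (h : AttainsRates α ρ n d) {k : ℕ} (hk : 1 ≤ k) :
    AttainsRates α ρ (k * n) ((k : ℝ) • d) := by
  induction k, hk using Nat.le_induction with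
  | base => simpa using h
  | succ k _ ih =>
    push_cast
    rw [add_smul, one_smul, Nat.add_mul, one_mul]
    exact ih.add hα hρ h

lemma AttainsRates.nonneg (hα : 1 < α) (hρ : ∀ x, IsState (ρ x)) {n : ℕ} {d : Fin r → ℝ}
    (h : AttainsRates α ρ n d) (x : Fin r) : 0 ≤ d x := by
  obtain ⟨τ, hτ, hd⟩ := h
  rw [← (hd x).2]
  exact renyiReal_nonneg hα hτ (isState_tensorPow (hρ x) n) (hd x).1

lemma attainsRates_one (hα : 1 < α) (hρ : ∀ x, IsState (ρ x)) {τ : Matrix A A ℂ}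
    (hτ : τ ∈ affStates A) (h : ∀ x, supp τ ≤ supp (ρ x)) :
    AttainsRates α ρ 1 (fun x => renyiReal α τ (ρ x)) := by
  refine ⟨_, affStates_tens ((Equiv.funUnique (Fin 1) A).trans (Equiv.prodPUnit A).symm) hτ
    (isState_one_of_unique (I := Unit)).mem_affStates, fun x => ?_⟩
  rw [tensorPow_one]
  refine ⟨supp_tens_le _ (h x) le_rfl, ?_⟩
  rw [renyiReal_tens _ hα hτ isState_one_of_unique.mem_affStates (hρ x) isState_one_of_unique
    (h x) le_rfl, renyiReal_one, add_zero]

end Rates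

/-! ### The converse bound on the error probability -/

section Converse

variable {A : Type*} [Fintype A] [DecidableEq A] {r : ℕ}
variable {ρ : Fin r → Matrix A A ℂ} {α : ℝ} {p : Fin r → ℝ}

lemma isPOVM_one_sub {I : Type*} [Fintype I] [DecidableEq I] {Λ : Fin r → Matrix I I ℂ}
    (hΛ : IsPOVM Λ) (x : Fin r) : (1 - Λ x).PosSemidef := by
  rw [← hΛ.2, ← Finset.add_sum_erase _ _ (Finset.mem_univ x), add_sub_cancel_left]
  exact Matrix.posSemidef_sum _ fun y _ => hΛ.1 y

/-- An operator attaining the divergences `d` on at least `m` copies bounds the error probability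
on `m` copies from below: at least one of the `r` outcomes of a POVM has weight at least `1/r` in
it. -/
lemma exists_pos_le_errorProb (hα : 1 < α) (hρ : ∀ x, IsState (ρ x)) (hp : ∀ x, 0 < p x)
    (hr : 0 < r) : ∃ c : ℝ, 0 < c ∧ ∀ (m j : ℕ) (d : Fin r → ℝ) (D : ℝ),
      AttainsRates α ρ (m + j) d → (∀ x, d x ≤ D) →
      c * Real.exp (-D) ≤ errorProb p (fun x => tensorPow m (ρ x)) := by
  have : Nonempty (Fin r) := ⟨⟨0, hr⟩⟩
  obtain ⟨x₀, hx₀⟩ := Finite.exists_min p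
  have hr' : (0 : ℝ) < r := by exact_mod_cast hr
  refine ⟨p x₀ * (1 / (r : ℝ)) ^ (α / (α - 1)), mul_pos (hp _) (by positivity), ?_⟩
  rintro m j d D ⟨τ, hτ, hd⟩ hD
  refine le_csInf ?_ ?_
  · classical
    refine ⟨_, fun x => if x = x₀ then 1 else 0, ⟨fun x => ?_, by simp⟩, rfl⟩
    dsimp only
    split_ifs
    · exact Matrix.PosSemidef.one
    · exact Matrix.PosSemidef.zero
  rintro _ ⟨Λ, hΛ, rfl⟩
  set e := (Fin.appendEquiv (α := A) m j).symm with he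
  set Λ' : Fin r → Matrix (Fin (m + j) → A) (Fin (m + j) → A) ℂ := fun x => tens e (Λ x) 1 with hΛ'
  have hsum : ∑ x, Λ' x = 1 := by
    rw [← tens_one_one e, ← hΛ.2]
    ext i k
    simp [hΛ', tens, Matrix.sum_apply, Finset.sum_mul]
  have hPOVM : IsPOVM Λ' := ⟨fun x => tens_posSemidef _ (hΛ.1 x) Matrix.PosSemidef.one, hsum⟩
  have htr : ∀ x, (Λ' x * tensorPow (m + j) (ρ x)).trace = (Λ x * tensorPow m (ρ x)).trace := by
    intro x
    rw [tensorPow_add, hΛ', tens_mul, trace_tens, Matrix.one_mul,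
      (isState_tensorPow (hρ x) j).2, mul_one]
  have hnn : ∀ x, 0 ≤ (Λ x * tensorPow m (ρ x)).trace.re := by
    intro x
    obtain ⟨V, s, hV, hs, hVs⟩ := exists_ofSpectrum_nonneg (isState_tensorPow (hρ x) m).1
    rw [hVs, trace_mul_ofSpectrum]
    exact Finset.sum_nonneg fun i _ => mul_nonneg (hs i) (quad_nonneg (hΛ.1 x) _ _)
  have hone : ∑ x, (Λ' x * τ).trace.re = 1 := by
    rw [← Complex.re_sum, ← Matrix.trace_sum, ← Finset.sum_mul, hsum, Matrix.one_mul, hτ.2]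
    rfl
  obtain ⟨x, -, hx⟩ : ∃ x ∈ Finset.univ, 1 / (r : ℝ) ≤ |(Λ' x * τ).trace.re| := by
    refine Finset.exists_le_of_sum_le Finset.univ_nonempty ?_
    rw [Finset.sum_const, Finset.card_univ, Fintype.card_fin, nsmul_eq_mul,
      mul_one_div_cancel hr'.ne', ← hone]
    exact Finset.sum_le_sum fun x _ => le_abs_self _
  have hmain := rpow_mul_exp_le_trace hα hτ (isState_tensorPow (hρ x) (m + j)) (hd x).1
    (hPOVM.1 x) (isPOVM_one_sub hPOVM x) (by positivity) hx
  rw [htr, (hd x).2] at hmain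
  calc p x₀ * (1 / (r : ℝ)) ^ (α / (α - 1)) * Real.exp (-D)
      ≤ p x₀ * ((1 / (r : ℝ)) ^ (α / (α - 1)) * Real.exp (-d x)) := by
        rw [mul_assoc]
        have := hp x₀
        have := hD x
        gcongr
    _ ≤ p x * (Λ x * tensorPow m (ρ x)).trace.re := by
        refine mul_le_mul (hx₀ x) hmain (by positivity) (hp x).le
    _ ≤ _ := Finset.single_le_sum (f := fun x => p x * (Λ x * tensorPow m (ρ x)).trace.re)
        (fun y _ => mul_nonneg (hp y).le (hnn y)) (Finset.mem_univ x)

lemma negLog_of_pos {t : ℝ} (ht : 0 < t) : negLog t = ((-Real.log t : ℝ) : EReal) := by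
  rw [negLog, ENNReal.log_ofReal_of_pos ht, EReal.coe_neg]

/-- The error exponent is at most the largest of the attained divergences per copy. -/
lemma errorExponentLimsup_le (hα : 1 < α) (hρ : ∀ x, IsState (ρ x)) (hp : ∀ x, 0 < p x)
    (hr : 0 < r) {n : ℕ} (hn : 1 ≤ n) {d : Fin r → ℝ} (h : AttainsRates α ρ n d) {v : ℝ}
    (hv : ∀ x, d x < n * v) : errorExponentLimsup p ρ ≤ (v : EReal) := by
  obtain ⟨c, hc, hbound⟩ := exists_pos_le_errorProb hα hρ hp hr
  have : Nonempty (Fin r) := ⟨⟨0, hr⟩⟩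
  obtain ⟨x₁, hx₁⟩ := Finite.exists_max d
  set D := d x₁ with hD
  have hD0 : 0 ≤ D := h.nonneg hα hρ x₁
  have hn' : (0 : ℝ) < n := by exact_mod_cast hn
  have hDv : D < n * v := hv x₁
  have hev : ∀ᶠ m : ℕ in atTop, (D - Real.log c) / (v - D / n) ≤ m :=
    tendsto_natCast_atTop_atTop.eventually_ge_atTop _
  refine limsup_le_of_le (by isBoundedDefault) ?_
  filter_upwards [hev, eventually_ge_atTop 1] with m hm hm1
  have hm' : (0 : ℝ) < m := by exact_mod_cast hm1
  set k := m / n + 1 with hk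
  -- `k * n` is the least multiple of `n` exceeding `m`.
  have hkm : m ≤ k * n := by
    have := Nat.lt_div_mul_add (a := m) (b := n) (by omega)
    rw [hk, Nat.add_mul]
    omega
  have hkn : (k : ℝ) ≤ m / n + 1 := by
    rw [hk]
    push_cast
    have : ((m / n : ℕ) : ℝ) ≤ (m : ℝ) / n := Nat.cast_div_le
    linarith
  have hrate := h.nsmul hα hρ (Nat.le_add_left 1 (m / n))
  rw [← hk] at hrate
  rw [← Nat.add_sub_of_le hkm] at hrate
  have hb := hbound m (k * n - m) _ (k * D) hrate fun x => by
    simp only [Pi.smul_apply, smul_eq_mul]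
    exact mul_le_mul_of_nonneg_left (hx₁ x) (by positivity)
  have hpos : 0 < errorProb p (fun x => tensorPow m (ρ x)) := lt_of_lt_of_le (by positivity) hb
  rw [negLog_of_pos hpos, ← EReal.coe_mul, EReal.coe_le_coe_iff]
  have hlog := Real.log_le_log (by positivity) hb
  rw [Real.log_mul hc.ne' (by positivity), Real.log_exp] at hlog
  have hvD : 0 < v - D / n := by
    rw [sub_pos, div_lt_iff₀ hn']
    linarith
  rw [div_le_iff₀ hvD] at hm
  rw [one_div, inv_mul_le_iff₀ hm']
  have : (k : ℝ) * D ≤ m * (D / n) + D := by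
    calc (k : ℝ) * D ≤ (m / n + 1) * D := by gcongr
      _ = _ := by ring
  nlinarith

end Converse

/-! ### The error exponent and the regularized radius -/

section Regularized

variable {A : Type*} [Fintype A] [DecidableEq A] {r : ℕ}
variable {ρ : Fin r → Matrix A A ℂ} {α : ℝ} {p : Fin r → ℝ}

/-- Any `v` below the error exponent is witnessed by one distribution `s` for all numbers of copies
at once. -/
lemma exists_stdSimplex_of_lt_errorExponentLimsup (hα : 1 < α) (hρ : ∀ x, IsState (ρ x))
    (hp : ∀ x, 0 < p x) (hr : 0 < r) {v : ℝ} (hv : (v : EReal) < errorExponentLimsup p ρ) :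
    ∃ s ∈ stdSimplex ℝ (Fin r), ∀ n d, 1 ≤ n → AttainsRates α ρ n d →
      n * v ≤ ∑ x, s x * d x := by
  have : Nonempty (Fin r) := ⟨⟨0, hr⟩⟩
  set G : Set (Fin r → ℝ) :=
    {g | ∃ n : ℕ, ∃ d, 1 ≤ n ∧ AttainsRates α ρ n d ∧ g = fun x => d x - n * v} with hG
  have hadd : ∀ g ∈ G, ∀ h ∈ G, g + h ∈ G := by
    rintro _ ⟨n, d, hn, hd, rfl⟩ _ ⟨m, d', hm, hd', rfl⟩
    refine ⟨n + m, d + d', by omega, hd.add hα hρ hd', ?_⟩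
    ext x
    simp only [Pi.add_apply]
    push_cast
    ring
  have hcoord : ∀ g ∈ G, ∃ x, 0 ≤ g x := by
    rintro _ ⟨n, d, hn, hd, rfl⟩
    by_contra! hneg
    exact absurd (errorExponentLimsup_le hα hρ hp hr hn hd (v := v) fun x => by
      linarith [hneg x]) (not_le.2 hv)
  obtain ⟨s, hs, h⟩ := exists_stdSimplex_of_add_mem hadd hcoord
  refine ⟨s, hs, fun n d hn hd => ?_⟩
  have := h _ ⟨n, d, hn, hd, rfl⟩
  simp only [mul_sub, Finset.sum_sub_distrib, ← Finset.sum_mul, hs.2, one_mul] at this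
  linarith

lemma sandwichedRenyi_nonneg (hα : 1 < α) {I : Type*} [Fintype I] [DecidableEq I]
    {γ σ : Matrix I I ℂ} (hγ : γ ∈ affStates I) (hσ : IsState σ) :
    0 ≤ sandwichedRenyi α γ σ := by
  by_cases h : supp γ ≤ supp σ
  · rw [sandwichedRenyi_of_le h]
    exact_mod_cast renyiReal_nonneg hα hγ hσ h
  · rw [sandwichedRenyi_of_not_le h]
    exact le_top

lemma sum_coe_mul_coe {ι : Type*} (t : Finset ι) (s d : ι → ℝ) :
    ∑ x ∈ t, ((s x : ℝ) : EReal) * ((d x : ℝ) : EReal) = ((∑ x ∈ t, s x * d x : ℝ) : EReal) := by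
  classical
  induction t using Finset.induction_on with
  | empty => simp
  | insert a t ha ih => rw [Finset.sum_insert ha, Finset.sum_insert ha, ih]; push_cast; rfl

/-- Mixing `s` with the uniform distribution makes an infinite divergence from any one of the
states count, at the price of a factor `1 - η`. -/
lemma le_mul_sum_sandwichedRenyi (hα : 1 < α) (hρ : ∀ x, IsState (ρ x)) (hr : 0 < r)
    {s : Fin r → ℝ} (hs : s ∈ stdSimplex ℝ (Fin r)) {v : ℝ}
    (h : ∀ n d, 1 ≤ n → AttainsRates α ρ n d → n * v ≤ ∑ x, s x * d x) {η : ℝ} (hη : 0 < η)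
    (hη1 : η < 1) {n : ℕ} (hn : 1 ≤ n) {τ : Matrix (Fin n → A) (Fin n → A) ℂ}
    (hτ : τ ∈ affStates (Fin n → A)) :
    (((1 - η) * v : ℝ) : EReal) ≤ ((1 / (n : ℝ) : ℝ) : EReal) *
      ∑ x, (((1 - η) * s x + η * (1 / r) : ℝ) : EReal) *
        sandwichedRenyi α τ (tensorPow n (ρ x)) := by
  have hr' : (0 : ℝ) < r := by exact_mod_cast hr
  have hn' : (0 : ℝ) < n := by exact_mod_cast hn
  have hpos : ∀ x, 0 < (1 - η) * s x + η * (1 / r) := fun x =>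
    add_pos_of_nonneg_of_pos (mul_nonneg (by linarith) (hs.1 x)) (by positivity)
  by_cases hsupp : ∀ x, supp τ ≤ supp (tensorPow n (ρ x))
  · set d : Fin r → ℝ := fun x => renyiReal α τ (tensorPow n (ρ x)) with hd
    have hrate : AttainsRates α ρ n d := ⟨τ, hτ, fun x => ⟨hsupp x, rfl⟩⟩
    simp only [fun x => sandwichedRenyi_of_le (α := α) (hsupp x)]
    rw [sum_coe_mul_coe, ← EReal.coe_mul, EReal.coe_le_coe_iff, one_div, ← div_eq_inv_mul,
      le_div_iff₀ hn']
    have h1 := h n d hn hrate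
    have h2 : 0 ≤ ∑ x, η * (1 / r) * d x :=
      Finset.sum_nonneg fun x _ => mul_nonneg (by positivity) (hrate.nonneg hα hρ x)
    calc (1 - η) * v * n = (1 - η) * (n * v) := by ring
      _ ≤ (1 - η) * ∑ x, s x * d x := mul_le_mul_of_nonneg_left h1 (by linarith)
      _ ≤ (1 - η) * ∑ x, s x * d x + ∑ x, η * (1 / r) * d x := by linarith
      _ = _ := by
        rw [Finset.mul_sum, ← Finset.sum_add_distrib]
        exact Finset.sum_congr rfl fun x _ => by ring
  · push Not at hsupp
    obtain ⟨x, hx⟩ := hsupp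
    have h1 : (⊤ : EReal) ≤ ∑ x, (((1 - η) * s x + η * (1 / r) : ℝ) : EReal) *
        sandwichedRenyi α τ (tensorPow n (ρ x)) := by
      refine le_trans (le_of_eq ?_) (Finset.single_le_sum
        (f := fun x => (((1 - η) * s x + η * (1 / r) : ℝ) : EReal) *
        sandwichedRenyi α τ (tensorPow n (ρ x))) (fun y _ => ?_) (Finset.mem_univ x))
      · rw [sandwichedRenyi_of_not_le hx, EReal.coe_mul_top_of_pos (hpos x)]
      · exact EReal.mul_nonneg (by exact_mod_cast (hpos y).le)
          (sandwichedRenyi_nonneg hα hτ (isState_tensorPow (hρ y) n))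
    rw [top_le_iff.1 h1, EReal.coe_mul_top_of_pos (by positivity)]
    exact le_top

theorem errorExponentLimsup_le_regularizedRadius (hρ : ∀ x, IsState (ρ x)) (hp : ∀ x, 0 < p x)
    (hr : 0 < r) : errorExponentLimsup p ρ ≤ regularizedRadius ρ := by
  refine le_iInf₂ fun α hα => ?_
  by_contra! hlt
  obtain ⟨w, hw1, hw2⟩ := EReal.lt_iff_exists_real_btwn.1 hlt
  obtain ⟨v, hv1, hv2⟩ := EReal.lt_iff_exists_real_btwn.1 hw2
  have hwv : w < v := by exact_mod_cast hv1
  obtain ⟨s, hs, h⟩ := exists_stdSimplex_of_lt_errorExponentLimsup hα hρ hp hr hv2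
  set η : ℝ := min (1 / 2) ((v - w) / (|v| + 1)) with hη
  have habs := abs_nonneg v
  have hη0 : 0 < η := lt_min (by norm_num) (div_pos (by linarith) (by linarith))
  have hη1 : η < 1 := (min_le_left _ _).trans_lt (by norm_num)
  have hηv : η * (|v| + 1) ≤ v - w := by
    rw [← le_div_iff₀ (by linarith)]
    exact min_le_right _ _
  have hwη : w ≤ (1 - η) * v := by nlinarith [le_abs_self v]
  have hr' : (0 : ℝ) < r := by exact_mod_cast hr
  have hs' : (fun x => (1 - η) * s x + η * (1 / r)) ∈ stdSimplex ℝ (Fin r) := by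
    refine ⟨fun x => add_nonneg (mul_nonneg (by linarith) (hs.1 x)) (by positivity), ?_⟩
    rw [Finset.sum_add_distrib, ← Finset.mul_sum, hs.2, Finset.sum_const, Finset.card_univ,
      Fintype.card_fin, nsmul_eq_mul]
    field_simp
    ring
  refine absurd hw1 (not_lt.2 (le_trans (b := (((1 - η) * v : ℝ) : EReal))
    (by exact_mod_cast hwη) ?_))
  refine le_limsup_of_frequently_le (Eventually.frequently ?_) (by isBoundedDefault)
  filter_upwards [eventually_ge_atTop 1] with n hn
  exact le_iSup₂_of_le _ hs' (le_iInf₂ fun τ hτ =>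
    le_mul_sum_sandwichedRenyi hα hρ hr hs h hη0 hη1 hn hτ)

/-- Tensor powers of a single state bound the regularized radius. -/
lemma regularizedRadius_le_of_renyiReal_le (hα : 1 < α) (hρ : ∀ x, IsState (ρ x))
    {τ : Matrix A A ℂ} (hτ : IsState τ) (h : ∀ x, supp τ ≤ supp (ρ x)) {c : ℝ}
    (hc : ∀ x, renyiReal α τ (ρ x) ≤ c) : regularizedRadius ρ ≤ (c : EReal) := by
  refine iInf₂_le_of_le α hα (limsup_le_of_le (by isBoundedDefault) ?_)
  filter_upwards [eventually_ge_atTop 1] with n hn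
  have hn' : (0 : ℝ) < n := by exact_mod_cast hn
  have hrate := (attainsRates_one hα hρ hτ.mem_affStates h).nsmul hα hρ hn
  rw [mul_one] at hrate
  obtain ⟨τn, hτn, hd⟩ := hrate
  refine iSup₂_le fun s hs => iInf₂_le_of_le τn hτn ?_
  simp only [fun x => sandwichedRenyi_of_le (α := α) (hd x).1, fun x => (hd x).2]
  rw [sum_coe_mul_coe, ← EReal.coe_mul, EReal.coe_le_coe_iff]
  calc 1 / (n : ℝ) * ∑ x, s x * ((n : ℝ) • fun x => renyiReal α τ (ρ x)) x
      = ∑ x, s x * renyiReal α τ (ρ x) := by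
        rw [Finset.mul_sum]
        refine Finset.sum_congr rfl fun x _ => ?_
        simp only [Pi.smul_apply, smul_eq_mul]
        field_simp
    _ ≤ ∑ x, s x * c := Finset.sum_le_sum fun x _ => mul_le_mul_of_nonneg_left (hc x) (hs.1 x)
    _ = c := by rw [← Finset.sum_mul, hs.2, one_mul]

end Regularized

/-! ### The sandwiched divergence for orders near one -/

section Limit

variable {I : Type*} [Fintype I] [DecidableEq I]

lemma quad_eq_zero_of_supp_le {V : Matrix I I ℂ} (hV : IsUnitaryMat V) {s : I → ℝ}
    {γ : Matrix I I ℂ} (h : supp γ ≤ supp (ofSpectrum V s)) {j : I} (hj : s j = 0) :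
    quad V γ j = 0 := by
  obtain ⟨X, rfl⟩ := supp_le_iff.1 h
  have : Vᴴ * (ofSpectrum V s * X) * V = diagonal (fun j => (s j : ℂ)) * (Vᴴ * X * V) := by
    rw [ofSpectrum]
    calc _ = (Vᴴ * V) * diagonal (fun j => (s j : ℂ)) * (Vᴴ * X * V) := by
          simp only [Matrix.mul_assoc]
      _ = _ := by rw [hV.1, Matrix.one_mul]
  rw [quad, this, diagonal_mul, hj]
  simp

lemma IsState.sum_quad {τ : Matrix I I ℂ} (hτ : IsState τ) {V : Matrix I I ℂ}
    (hV : IsUnitaryMat V) : ∑ j, quad V τ j = 1 := by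
  rw [quad_trace hV, hτ.2, Complex.one_re]

lemma IsState.le_one {V : Matrix I I ℂ} (hV : IsUnitaryMat V) {s : I → ℝ} (hs : ∀ i, 0 ≤ s i)
    (h : IsState (ofSpectrum V s)) (i : I) : s i ≤ 1 := by
  have h1 := trace_ofSpectrum hV s
  rw [h.2, Complex.one_re] at h1
  rw [h1]
  exact Finset.single_le_sum (fun j _ => hs j) (Finset.mem_univ i)

/-- An upper bound on `Tr (σ^(-c) τ σ^(-c))^α` by quantities that are explicit in the spectra and
overlaps of `τ` and `σ`. With `Y = σ^(-c) τ σ^(-c)` and `T = σ^c`, Peierls' inequality for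
`τ = T Y T` in the eigenbasis `uᵢ` of `Y` gives `∑ yᵢ^α ⟨uᵢ, T uᵢ⟩^(2α) ≤ Tr τ^α`. -/
lemma schattenNorm_sandwich_rpow_le {α : ℝ} (hα : 1 < α) {P V : Matrix I I ℂ}
    (hP : IsUnitaryMat P) (hV : IsUnitaryMat V) {t s : I → ℝ} (ht : ∀ i, 0 ≤ t i)
    (hs : ∀ i, 0 ≤ s i) (hτ : IsState (ofSpectrum P t)) (hσ : IsState (ofSpectrum V s))
    (h : supp (ofSpectrum P t) ≤ supp (ofSpectrum V s)) {c : ℝ} (hc : c = (α - 1) / (2 * α)) :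
    schattenNorm α (sandwich α (ofSpectrum P t) (ofSpectrum V s)) ^ α ≤ ∑ i, t i ^ α +
      2 * α * (∑ j, quad V (ofSpectrum P t) j * (s j ^ (-c) * s j ^ (-c))) ^ (α - 1) *
      ∑ j, quad V (ofSpectrum P t) j * (s j ^ (-c) * (1 - s j ^ c) * s j ^ (-c)) := by
  set τ := ofSpectrum P t with hτdef
  have hα0 : 0 < α := by linarith
  have hc0 : 0 ≤ c := by rw [hc]; exact div_nonneg (by linarith) (by linarith)
  set T := ofSpectrum V (fun j => s j ^ c) with hT
  set S := ofSpectrum V (fun j => s j ^ (-c)) with hS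
  have hTh : Tᴴ = T := (ofSpectrum_isHermitian _ _).eq
  have hSh : Sᴴ = S := (ofSpectrum_isHermitian _ _).eq
  have hY : sandwich α τ (ofSpectrum V s) = S * τ * S := by
    rw [sandwich, powOnSupp_ofSpectrum hV, show (1 - α) / (2 * α) = -c by rw [hc]; ring]
  have hYpos : (S * τ * S).PosSemidef := by
    have := hτ.1.conjTranspose_mul_mul_same S
    rwa [hSh] at this
  obtain ⟨U, y, hU, hy, hYU⟩ := exists_ofSpectrum_nonneg hYpos
  have hTYT : T * ofSpectrum U y * T = τ := by
    rw [← hYU]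
    exact conj_pow_conj_pow_neg hV hs hτ.1.1 h c
  rw [hY, hYU, schattenNorm_ofSpectrum hU, ← Real.rpow_mul
    (Finset.sum_nonneg fun i _ => Real.rpow_nonneg (abs_nonneg _) _),
    one_div_mul_cancel hα0.ne', Real.rpow_one]
  simp only [fun i => abs_of_nonneg (hy i)]
  have hTi : ∀ i, 0 ≤ quad U T i := fun i =>
    quad_nonneg (ofSpectrum_posSemidef V fun j => Real.rpow_nonneg (hs j) _) _ _
  have h1T : ∀ i, quad U (1 - T) i = 1 - quad U T i := fun i => by rw [quad_sub, quad_one hU]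
  have h1Tpos : (1 - T).PosSemidef := by
    rw [← ofSpectrum_one hV, hT, ofSpectrum_sub]
    exact ofSpectrum_posSemidef V fun j =>
      sub_nonneg.2 (Real.rpow_le_one (hs j) (hσ.le_one hV hs j) hc0)
  have h1Ti : ∀ i, 0 ≤ 1 - quad U T i := fun i => by
    rw [← h1T]; exact quad_nonneg h1Tpos _ _
  have hdiag : ∀ i, y i * quad U T i ^ 2 ≤ quad U τ i := by
    intro i
    have hq : quad U τ i = ∑ k, overlap U (T * U) k i * y k := by
      rw [← quad_ofSpectrum, ← quad_conj, hTh, hTYT]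
    rw [hq]
    refine le_trans ?_ (Finset.single_le_sum (f := fun k => overlap U (T * U) k i * y k)
      (fun k _ => mul_nonneg (overlap_nonneg _ _ _ _) (hy k)) (Finset.mem_univ i))
    rw [mul_comm]
    refine mul_le_mul_of_nonneg_right ?_ (hy i)
    rw [overlap, quad, ← Matrix.mul_assoc, Complex.normSq_apply, pow_two]
    nlinarith [mul_self_nonneg ((Uᴴ * T * U) i i).im]
  have hpeierls : ∑ i, (y i * quad U T i ^ 2) ^ α ≤ ∑ i, t i ^ α :=
    (Finset.sum_le_sum fun i _ => Real.rpow_le_rpow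
      (mul_nonneg (hy i) (sq_nonneg _)) (hdiag i) hα0.le).trans
      (sum_convexOn_quad_le hP (convexOn_rpow hα.le) (fun j => ht j) hU)
  have hbern : ∀ i, y i ^ α - 2 * α * (y i ^ α * (1 - quad U T i)) ≤
      (y i * quad U T i ^ 2) ^ α := by
    intro i
    rw [Real.mul_rpow (hy i) (sq_nonneg _), ← Real.rpow_natCast, ← Real.rpow_mul (hTi i)]
    have := one_add_mul_self_le_rpow_one_add (s := quad U T i - 1) (p := (2 : ℕ) * α)
      (by linarith [hTi i]) (by push_cast; linarith)
    rw [add_sub_cancel] at this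
    have h2 := mul_le_mul_of_nonneg_left this (Real.rpow_nonneg (hy i) α)
    push_cast at h2 ⊢
    linarith
  set m := ∑ j, quad V τ j * (s j ^ (-c) * s j ^ (-c)) with hm
  have hsumy : ∑ i, y i = m := by
    rw [← trace_ofSpectrum hU, ← hYU, Matrix.mul_assoc, Matrix.trace_mul_comm, Matrix.mul_assoc,
      hS, ofSpectrum_mul hV, trace_mul_ofSpectrum]
    exact Finset.sum_congr rfl fun j _ => mul_comm _ _
  have hym : ∀ i, y i ≤ m := fun i => by
    rw [← hsumy]
    exact Finset.single_le_sum (fun j _ => hy j) (Finset.mem_univ i)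
  have hyα : ∀ i, y i ^ α ≤ m ^ (α - 1) * y i := by
    intro i
    rcases (hy i).eq_or_lt with h0 | h0
    · rw [← h0, Real.zero_rpow hα0.ne', mul_zero]
    · calc y i ^ α = y i ^ (α - 1) * y i := by
            rw [Real.rpow_sub_one h0.ne']; field_simp
        _ ≤ _ := by
          have := hym i
          gcongr
  have hlast : ∑ i, y i * (1 - quad U T i) =
      ∑ j, quad V τ j * (s j ^ (-c) * (1 - s j ^ c) * s j ^ (-c)) := by
    simp only [← h1T]
    rw [← trace_mul_ofSpectrum, ← hYU]
    have h3 : ((1 - T) * (S * τ * S)).trace = (τ * (S * (1 - T) * S)).trace := by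
      rw [← Matrix.mul_assoc, Matrix.trace_mul_comm, ← Matrix.mul_assoc, ← Matrix.mul_assoc,
        Matrix.trace_mul_comm, ← Matrix.mul_assoc, ← Matrix.mul_assoc]
    rw [h3, ← ofSpectrum_one hV, hT, hS, ofSpectrum_sub, ofSpectrum_mul hV, ofSpectrum_mul hV,
      trace_mul_ofSpectrum]
    exact Finset.sum_congr rfl fun j _ => mul_comm _ _
  have hfin : ∑ i, y i ^ α * (1 - quad U T i) ≤
      m ^ (α - 1) * ∑ j, quad V τ j * (s j ^ (-c) * (1 - s j ^ c) * s j ^ (-c)) := by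
    rw [← hlast, Finset.mul_sum]
    refine Finset.sum_le_sum fun i _ => ?_
    rw [← mul_assoc]
    exact mul_le_mul_of_nonneg_right (hyα i) (h1Ti i)
  have hsum := (Finset.sum_le_sum fun i (_ : i ∈ Finset.univ) => hbern i).trans hpeierls
  rw [Finset.sum_sub_distrib, ← Finset.mul_sum] at hsum
  have := mul_le_mul_of_nonneg_left hfin (by linarith : 0 ≤ 2 * α)
  rw [mul_assoc]
  linarith

lemma trace_mul_log_self {P : Matrix I I ℂ} (hP : IsUnitaryMat P) (t : I → ℝ) :
    (ofSpectrum P t * logOnSupp (ofSpectrum P t)).trace.re = ∑ i, t i * Real.log (t i) := by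
  rw [logOnSupp_ofSpectrum hP, trace_mul_ofSpectrum]
  simp only [quad_ofSpectrum_self hP, mul_comm]

lemma trace_mul_log_sub {P V : Matrix I I ℂ} (hP : IsUnitaryMat P) (hV : IsUnitaryMat V)
    (t s : I → ℝ) :
    (ofSpectrum P t * (logOnSupp (ofSpectrum P t) - logOnSupp (ofSpectrum V s))).trace.re =
      ∑ i, t i * Real.log (t i) - ∑ j, quad V (ofSpectrum P t) j * Real.log (s j) := by
  rw [Matrix.mul_sub, Matrix.trace_sub, Complex.sub_re, trace_mul_log_self hP,
    logOnSupp_ofSpectrum hV, trace_mul_ofSpectrum]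
  simp only [mul_comm]

lemma hasDerivAt_rpow_one {t : ℝ} (ht : 0 ≤ t) :
    HasDerivAt (fun α : ℝ => t ^ α) (t * Real.log t) 1 := by
  rcases ht.eq_or_lt with rfl | ht
  · have : (fun α : ℝ => (0 : ℝ) ^ α) =ᶠ[𝓝 1] fun _ => 0 := by
      filter_upwards [lt_mem_nhds (show (0 : ℝ) < 1 by norm_num)] with α hα
      exact Real.zero_rpow hα.ne'
    simpa using (hasDerivAt_const (1 : ℝ) (0 : ℝ)).congr_of_eventuallyEq this
  · simpa [mul_comm] using (hasDerivAt_id (1 : ℝ)).const_rpow ht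

/-- The divergence of order `α` is asymptotically at most the relative entropy as `α ↘ 1`. -/
lemma eventually_renyiReal_le {τ σ : Matrix I I ℂ} (hτ : IsState τ) (hσ : IsState σ)
    (h : supp τ ≤ supp σ) {b : ℝ}
    (hb : (τ * (logOnSupp τ - logOnSupp σ)).trace.re < b) :
    ∀ᶠ α in 𝓝[>] (1 : ℝ), renyiReal α τ σ ≤ b := by
  obtain ⟨P, t, hP, ht, rfl⟩ := exists_ofSpectrum_nonneg hτ.1
  obtain ⟨V, s, hV, hs, rfl⟩ := exists_ofSpectrum_nonneg hσ.1
  rw [trace_mul_log_sub hP hV] at hb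
  set w : I → ℝ := fun j => quad V (ofSpectrum P t) j with hw
  have hwsum : ∑ j, w j = 1 := hτ.sum_quad hV
  have hw0 : ∀ j, s j = 0 → w j = 0 := fun j hj => quad_eq_zero_of_supp_le hV h hj
  set c : ℝ → ℝ := fun α => (α - 1) / (2 * α) with hc
  have hc1 : c 1 = 0 := by simp [hc]
  have hcd : HasDerivAt c (1 / 2) 1 := by
    have := ((hasDerivAt_id (1 : ℝ)).sub_const 1).div ((hasDerivAt_id (1 : ℝ)).const_mul 2)
      (by norm_num)
    exact this.congr_deriv (by norm_num)
  have hpow : ∀ j, 0 < s j → HasDerivAt (fun α => s j ^ (-c α)) (-(Real.log (s j) / 2)) 1 := by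
    intro j hj
    have := hcd.neg.const_rpow hj
    simp only [Pi.neg_apply, hc1, neg_zero, Real.rpow_zero, mul_one] at this
    convert this using 1
    ring
  have hpow' : ∀ j, 0 < s j → HasDerivAt (fun α => s j ^ c α) (Real.log (s j) / 2) 1 := by
    intro j hj
    have := hcd.const_rpow hj
    simp only [hc1, Real.rpow_zero, mul_one] at this
    convert this using 1
    ring
  set m : ℝ → ℝ := fun α => ∑ j, w j * (s j ^ (-c α) * s j ^ (-c α)) with hm
  set k : ℝ → ℝ := fun α => ∑ j, w j * (s j ^ (-c α) * (1 - s j ^ c α) * s j ^ (-c α)) with hk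
  have hm1 : m 1 = 1 := by simp [hm, hc1, hwsum]
  have hk1 : k 1 = 0 := by simp [hk, hc1]
  have hmd : DifferentiableAt ℝ m 1 := by
    refine DifferentiableAt.fun_sum fun j _ => ?_
    rcases (hs j).eq_or_lt with hj | hj
    · simp [hw0 j hj.symm]
    · exact (((hpow j hj).mul (hpow j hj)).const_mul _).differentiableAt
  have hkd : HasDerivAt k (∑ j, w j * (-(Real.log (s j) / 2))) 1 := by
    refine HasDerivAt.fun_sum fun j _ => ?_
    rcases (hs j).eq_or_lt with hj | hj
    · simpa [hw0 j hj.symm] using hasDerivAt_const (1 : ℝ) (0 : ℝ)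
    · have := (((hpow j hj).mul ((hpow' j hj).const_sub 1)).mul (hpow j hj)).const_mul (w j)
      simpa [hc1] using this
  set g : ℝ → ℝ := fun α => 2 * α * m α ^ (α - 1) with hg
  have hg1 : g 1 = 2 := by simp [hg]
  have hgd : DifferentiableAt ℝ g 1 :=
    (differentiableAt_id.const_mul 2).mul
      (hmd.rpow (differentiableAt_id.sub_const 1) (by rw [hm1]; norm_num))
  set F : ℝ → ℝ := fun α => ∑ i, t i ^ α + g α * k α with hF
  have htsum : ∑ i, t i = 1 := by
    rw [← trace_ofSpectrum hP, hτ.2, Complex.one_re]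
  have hF1 : F 1 = 1 := by simp [hF, hk1, htsum]
  have hFd : HasDerivAt F (∑ i, t i * Real.log (t i) - ∑ j, w j * Real.log (s j)) 1 := by
    have h1 : HasDerivAt (fun α : ℝ => ∑ i, t i ^ α) (∑ i, t i * Real.log (t i)) 1 :=
      HasDerivAt.fun_sum fun i _ => hasDerivAt_rpow_one (ht i)
    have h2 := h1.add (hgd.hasDerivAt.mul hkd)
    refine h2.congr_deriv ?_
    rw [hk1, hg1, mul_zero, zero_add, sub_eq_add_neg, Finset.mul_sum, ← Finset.sum_neg_distrib]
    congr 1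
    exact Finset.sum_congr rfl fun j _ => by simp only [w]; ring
  have hslope := (hasDerivAt_iff_tendsto_slope.1 hFd).mono_left
    (nhdsWithin_mono (1 : ℝ) fun α (hα : 1 < α) => hα.ne')
  filter_upwards [hslope.eventually (gt_mem_nhds hb), self_mem_nhdsWithin] with α hα hα1
  have hα1' : 0 < α - 1 := sub_pos.2 hα1
  have hQ := schattenNorm_sandwich_rpow_le hα1 hP hV ht hs hτ hσ h (c := c α) rfl
  rw [slope_def_field, hF1, div_lt_iff₀ hα1'] at hα
  have hN := one_le_schattenNorm_sandwich hα1 hτ.mem_affStates hσ h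
  rw [renyiReal, one_div, inv_mul_le_iff₀ hα1']
  refine (Real.log_le_sub_one_of_pos (by positivity)).trans ?_
  have : F α = ∑ i, t i ^ α + 2 * α * m α ^ (α - 1) * k α := rfl
  linarith

end Limit

section Regularized

variable {A : Type*} [Fintype A] [DecidableEq A] {r : ℕ} {ρ : Fin r → Matrix A A ℂ}

theorem regularizedRadius_le_umegakiRadius (hρ : ∀ x, IsState (ρ x)) :
    regularizedRadius ρ ≤ umegakiRadius ρ := by
  refine le_iInf₂ fun τ hτ => ?_
  have hτ' : IsState τ := hτ
  refine EReal.le_of_forall_lt_iff_le.1 fun b hb => ?_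
  have hx : ∀ x, umegaki τ (ρ x) < b := fun x => (le_iSup _ x).trans_lt hb
  have hsupp : ∀ x, supp τ ≤ supp (ρ x) := by
    intro x
    by_contra hcon
    have := hx x
    rw [umegaki, if_neg hcon] at this
    exact not_top_lt this
  have hlt : ∀ x, (τ * (logOnSupp τ - logOnSupp (ρ x))).trace.re < b := by
    intro x
    have := hx x
    rw [umegaki, if_pos (hsupp x)] at this
    exact_mod_cast this
  have hev : ∀ᶠ α in 𝓝[>] (1 : ℝ), 1 < α ∧ ∀ x, renyiReal α τ (ρ x) ≤ b :=
    (eventually_mem_nhdsWithin (s := Set.Ioi (1 : ℝ))).and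
      (eventually_all.2 fun x => eventually_renyiReal_le hτ' (hρ x) (hsupp x) (hlt x))
  obtain ⟨α, hα, hle⟩ := hev.exists
  exact regularizedRadius_le_of_renyiReal_le hα hρ hτ' hsupp hle

end Regularized

/-! ### Entropy, the Gibbs variational principle and compactness -/

section Gibbs

variable {I : Type*} [Fintype I] [DecidableEq I]

/-- The negative von Neumann entropy `Tr τ ln τ`. -/
noncomputable def negEntropy (τ : Matrix I I ℂ) : ℝ :=
  (τ * logOnSupp τ).trace.re

lemma sum_quad_mul_log_le {τ : Matrix I I ℂ} (hτ : τ.PosSemidef) {U : Matrix I I ℂ}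
    (hU : IsUnitaryMat U) :
    ∑ i, quad U τ i * Real.log (quad U τ i) ≤ negEntropy τ := by
  obtain ⟨P, t, hP, ht, rfl⟩ := exists_ofSpectrum_nonneg hτ
  rw [negEntropy, trace_mul_log_self hP]
  exact sum_convexOn_quad_le hP Real.convexOn_mul_log (fun j => ht j) hU

lemma exists_sum_quad_mul_log_eq {τ : Matrix I I ℂ} (hτ : τ.PosSemidef) :
    ∃ U : Matrix I I ℂ, IsUnitaryMat U ∧
      ∑ i, quad U τ i * Real.log (quad U τ i) = negEntropy τ := by
  obtain ⟨P, t, hP, ht, rfl⟩ := exists_ofSpectrum_nonneg hτ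
  refine ⟨P, hP, ?_⟩
  rw [negEntropy, trace_mul_log_self hP]
  simp only [quad_ofSpectrum_self hP]

lemma isState_smul_add {τ τ' : Matrix I I ℂ} (hτ : IsState τ) (hτ' : IsState τ') {a b : ℝ}
    (ha : 0 ≤ a) (hb : 0 ≤ b) (hab : a + b = 1) : IsState (a • τ + b • τ') := by
  refine ⟨(hτ.1.smul ha).add (hτ'.1.smul hb), ?_⟩
  rw [Matrix.trace_add, Matrix.trace_smul, Matrix.trace_smul, hτ.2, hτ'.2, ← add_smul, hab,
    one_smul]

lemma negEntropy_convex {τ τ' : Matrix I I ℂ} (hτ : τ.PosSemidef) (hτ' : τ'.PosSemidef)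
    {a b : ℝ} (ha : 0 ≤ a) (hb : 0 ≤ b) (hab : a + b = 1) :
    negEntropy (a • τ + b • τ') ≤ a * negEntropy τ + b * negEntropy τ' := by
  obtain ⟨U, hU, hUeq⟩ := exists_sum_quad_mul_log_eq ((hτ.smul ha).add (hτ'.smul hb))
  rw [← hUeq]
  refine le_trans ?_ (add_le_add (mul_le_mul_of_nonneg_left (sum_quad_mul_log_le hτ hU) ha)
    (mul_le_mul_of_nonneg_left (sum_quad_mul_log_le hτ' hU) hb))
  rw [Finset.mul_sum, Finset.mul_sum, ← Finset.sum_add_distrib]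
  refine Finset.sum_le_sum fun i _ => ?_
  rw [quad_add, quad_smul, quad_smul]
  have := Real.convexOn_mul_log.2 (quad_nonneg hτ U i) (quad_nonneg hτ' U i) ha hb hab
  simpa [smul_eq_mul] using this

lemma expHerm_ofSpectrum {W : Matrix I I ℂ} (hW : IsUnitaryMat W) (h : I → ℝ) :
    expHerm (ofSpectrum W h) = ofSpectrum W (fun i => Real.exp (h i)) :=
  cfc_ofSpectrum hW h _

lemma IsState.nonempty {τ : Matrix I I ℂ} (hτ : IsState τ) : Nonempty I := by
  by_contra hI
  rw [not_nonempty_iff] at hI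
  have := hτ.2
  simp [Matrix.trace] at this

lemma trace_expHerm_pos [Nonempty I] {H : Matrix I I ℂ} (hH : H.IsHermitian) :
    0 < (expHerm H).trace.re := by
  obtain ⟨W, h, hW, rfl⟩ := exists_ofSpectrum hH
  rw [expHerm_ofSpectrum hW, trace_ofSpectrum hW]
  exact Finset.sum_pos (fun i _ => Real.exp_pos _) Finset.univ_nonempty

/-- The Gibbs variational inequality. -/
lemma neg_log_trace_expHerm_le {H τ : Matrix I I ℂ} (hH : H.IsHermitian) (hτ : IsState τ) :
    -Real.log (expHerm H).trace.re ≤ negEntropy τ - (τ * H).trace.re := by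
  have := hτ.nonempty
  obtain ⟨W, h, hW, rfl⟩ := exists_ofSpectrum hH
  obtain ⟨P, t, hP, ht, rfl⟩ := exists_ofSpectrum_nonneg hτ.1
  rw [negEntropy, trace_mul_log_self hP, expHerm_ofSpectrum hW, trace_ofSpectrum hW,
    Matrix.trace_mul_comm, trace_mul_ofSpectrum]
  set q : I → ℝ := fun i => quad P (ofSpectrum W h) i with hq
  set Z := ∑ i, Real.exp (h i) with hZ
  have hZ0 : 0 < Z := Finset.sum_pos (fun i _ => Real.exp_pos _) Finset.univ_nonempty
  have hpei : ∑ i, Real.exp (q i) ≤ Z :=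
    sum_convexOn_quad_le hW convexOn_exp (fun j => Set.mem_univ _) hP
  have htsum : ∑ i, t i = 1 := by rw [← trace_ofSpectrum hP, hτ.2, Complex.one_re]
  have hterm : ∀ i, t i * (q i - Real.log (t i) - Real.log Z) ≤ Real.exp (q i) / Z - t i := by
    intro i
    rcases (ht i).eq_or_lt with h0 | h0
    · rw [← h0]
      simp only [zero_mul, sub_zero]
      positivity
    · have h1 := Real.log_le_sub_one_of_pos (x := Real.exp (q i) / (t i * Z)) (by positivity)
      rw [Real.log_div (by positivity) (by positivity), Real.log_exp,
        Real.log_mul h0.ne' hZ0.ne'] at h1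
      have h2 := mul_le_mul_of_nonneg_left h1 h0.le
      have h3 : t i * (Real.exp (q i) / (t i * Z) - 1) = Real.exp (q i) / Z - t i := by
        field_simp
      linarith
  have hsum := Finset.sum_le_sum fun i (_ : i ∈ Finset.univ) => hterm i
  rw [Finset.sum_sub_distrib, ← Finset.sum_div, htsum] at hsum
  have h4 : (∑ i, Real.exp (q i)) / Z ≤ 1 := (div_le_one hZ0).2 hpei
  have h5 : ∑ i, t i * (q i - Real.log (t i) - Real.log Z) =
      ∑ i, t i * q i - ∑ i, t i * Real.log (t i) - Real.log Z := by
    simp only [mul_sub, Finset.sum_sub_distrib, ← Finset.sum_mul, htsum, one_mul]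
  linarith

/-- The Gibbs state attains the variational bound. -/
lemma exists_neg_log_trace_expHerm_eq [Nonempty I] {H : Matrix I I ℂ} (hH : H.IsHermitian) :
    ∃ τ, IsState τ ∧ -Real.log (expHerm H).trace.re = negEntropy τ - (τ * H).trace.re := by
  obtain ⟨W, h, hW, rfl⟩ := exists_ofSpectrum hH
  set Z := ∑ i, Real.exp (h i) with hZ
  have hZ0 : 0 < Z := Finset.sum_pos (fun i _ => Real.exp_pos _) Finset.univ_nonempty
  set t : I → ℝ := fun i => Real.exp (h i) / Z with ht
  have htsum : ∑ i, t i = 1 := by rw [ht, ← Finset.sum_div, div_self hZ0.ne']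
  have hpsd : (ofSpectrum W t).PosSemidef := ofSpectrum_posSemidef W fun j => by positivity
  refine ⟨ofSpectrum W t, ⟨hpsd, ?_⟩, ?_⟩
  · refine Complex.ext ?_ ?_
    · rw [trace_ofSpectrum hW, htsum, Complex.one_re]
    · have := Matrix.PosSemidef.trace_nonneg hpsd
      simpa using (Complex.le_def.1 this).2.symm
  · rw [negEntropy, trace_mul_log_self hW, expHerm_ofSpectrum hW, trace_ofSpectrum hW,
      trace_mul_ofSpectrum]
    simp only [quad_ofSpectrum_self hW]
    have hlog : ∀ i, Real.log (t i) = h i - Real.log Z := fun i => by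
      rw [ht, Real.log_div (Real.exp_pos _).ne' hZ0.ne', Real.log_exp]
    simp only [hlog, mul_sub, Finset.sum_sub_distrib, ← Finset.sum_mul, htsum]
    rw [Finset.sum_congr rfl fun i _ => mul_comm (h i) (t i)]
    ring

lemma continuous_quad (U : Matrix I I ℂ) (i : I) :
    Continuous fun τ : Matrix I I ℂ => quad U τ i := by
  unfold quad
  exact Complex.continuous_re.comp
    (((continuous_const.matrix_mul continuous_id).matrix_mul continuous_const).matrix_elem i i)

lemma isClosed_states : IsClosed (states I) := by
  have h : states I = {τ : Matrix I I ℂ | τᴴ = τ} ∩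
      (⋂ U ∈ {U : Matrix I I ℂ | IsUnitaryMat U}, ⋂ i, {τ | 0 ≤ quad U τ i}) ∩
      {τ | τ.trace = 1} := by
    ext τ
    simp only [states, IsState, Set.mem_ofPred_eq, Set.mem_inter_iff, Set.mem_iInter]
    refine and_congr_left fun _ => ⟨fun h => ⟨h.1, fun U _ i => quad_nonneg h U i⟩, fun h => ?_⟩
    obtain ⟨W, d, hW, rfl⟩ := exists_ofSpectrum h.1
    refine ofSpectrum_posSemidef W fun j => ?_
    rw [← quad_ofSpectrum_self hW d j]
    exact h.2 W hW j
  rw [h]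
  refine (IsClosed.inter ?_ ?_).inter ?_
  · exact isClosed_eq continuous_id.matrix_conjTranspose continuous_id
  · exact isClosed_biInter fun U _ => isClosed_iInter fun i =>
      isClosed_le continuous_const (continuous_quad U i)
  · exact isClosed_eq continuous_id.matrix_trace continuous_const

lemma isCompact_states : IsCompact (states I) := by
  have hcomp : IsCompact ((Set.univ : Set I).pi fun _ : I => (Set.univ : Set I).pi fun _ : I =>
      Metric.closedBall (0 : ℂ) 1) :=
    isCompact_univ_pi fun _ => isCompact_univ_pi fun _ => isCompact_closedBall _ _
  refine IsCompact.of_isClosed_subset (X := Matrix I I ℂ) hcomp isClosed_states ?_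
  intro τ hτ i _ j _
  rw [mem_closedBall_zero_iff]
  have hτ' : IsState τ := hτ
  have hsq : ‖τ i j‖ ^ 2 ≤ quad 1 (τ * τ) j := by
    have h1 : quad 1 (τ * τ) j = ∑ k, Complex.normSq (τ k j) := by
      rw [quad]
      conv_lhs => rw [show τ * τ = τᴴ * τ by rw [hτ'.1.1.eq]]
      rw [conjTranspose_one, Matrix.one_mul, Matrix.mul_one, Matrix.mul_apply, Complex.re_sum]
      refine Finset.sum_congr rfl fun k _ => ?_
      simp [Complex.normSq_apply]
    rw [h1, ← Complex.normSq_eq_norm_sq]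
    exact Finset.single_le_sum (f := fun k => Complex.normSq (τ k j))
      (fun k _ => Complex.normSq_nonneg _) (Finset.mem_univ i)
  obtain ⟨P, t, hP, ht, rfl⟩ := exists_ofSpectrum_nonneg hτ'.1
  have h2 : quad 1 (ofSpectrum P t * ofSpectrum P t) j ≤ 1 := by
    rw [ofSpectrum_mul hP, quad_ofSpectrum, ← quad_one isUnitaryMat_one j, ← sum_overlap_left hP]
    refine Finset.sum_le_sum fun k _ => mul_le_of_le_one_right (overlap_nonneg _ _ _ _) ?_
    have := hτ'.le_one hP ht k
    exact mul_le_one₀ this (ht k) this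
  nlinarith [norm_nonneg (ofSpectrum P t i j)]

end Gibbs

/-! ### The regularized relative entropy -/

section RegEntropy

variable {I : Type*} [Fintype I] [DecidableEq I]

/-- The relative entropy `D(τ‖σ + ε I)`, as a real number. -/
noncomputable def regEntropy (τ σ : Matrix I I ℂ) (ε : ℝ) : ℝ :=
  negEntropy τ - (τ * logOnSupp (σ + ε • (1 : Matrix I I ℂ))).trace.re

lemma logOnSupp_add_smul_one {V : Matrix I I ℂ} (hV : IsUnitaryMat V) (s : I → ℝ) (ε : ℝ) :
    logOnSupp (ofSpectrum V s + ε • (1 : Matrix I I ℂ)) =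
      ofSpectrum V (fun j => Real.log (s j + ε)) := by
  rw [← ofSpectrum_one hV, ofSpectrum_smul, ofSpectrum_add, logOnSupp_ofSpectrum hV]
  simp

lemma regEntropy_ofSpectrum {V : Matrix I I ℂ} (hV : IsUnitaryMat V) (τ : Matrix I I ℂ)
    (s : I → ℝ) (ε : ℝ) : regEntropy τ (ofSpectrum V s) ε =
      negEntropy τ - ∑ j, quad V τ j * Real.log (s j + ε) := by
  rw [regEntropy, logOnSupp_add_smul_one hV, trace_mul_ofSpectrum]
  simp only [mul_comm]

lemma regEntropy_anti {τ σ : Matrix I I ℂ} (hτ : τ.PosSemidef) (hσ : σ.PosSemidef) {ε ε' : ℝ}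
    (hε : 0 < ε) (h : ε ≤ ε') : regEntropy τ σ ε' ≤ regEntropy τ σ ε := by
  obtain ⟨V, s, hV, hs, rfl⟩ := exists_ofSpectrum_nonneg hσ
  rw [regEntropy_ofSpectrum hV, regEntropy_ofSpectrum hV]
  refine sub_le_sub_left (Finset.sum_le_sum fun j _ => mul_le_mul_of_nonneg_left ?_
    (quad_nonneg hτ _ _)) _
  exact Real.log_le_log (add_pos_of_nonneg_of_pos (hs j) hε) (by linarith)

lemma umegaki_real_eq {τ σ : Matrix I I ℂ} {V : Matrix I I ℂ} (hV : IsUnitaryMat V) {s : I → ℝ}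
    (hσ : σ = ofSpectrum V s) : (τ * (logOnSupp τ - logOnSupp σ)).trace.re =
      negEntropy τ - ∑ j, quad V τ j * Real.log (s j) := by
  rw [hσ, Matrix.mul_sub, Matrix.trace_sub, Complex.sub_re, logOnSupp_ofSpectrum hV,
    trace_mul_ofSpectrum, negEntropy]
  simp only [mul_comm]

lemma regEntropy_le_umegaki {τ σ : Matrix I I ℂ} (hτ : τ.PosSemidef) (hσ : σ.PosSemidef) {ε : ℝ}
    (hε : 0 < ε) : (regEntropy τ σ ε : EReal) ≤ umegaki τ σ := by
  by_cases h : supp τ ≤ supp σ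
  · rw [umegaki, if_pos h, EReal.coe_le_coe_iff]
    obtain ⟨V, s, hV, hs, rfl⟩ := exists_ofSpectrum_nonneg hσ
    rw [regEntropy_ofSpectrum hV, umegaki_real_eq hV rfl]
    refine sub_le_sub_left (Finset.sum_le_sum fun j _ => ?_) _
    rcases (hs j).eq_or_lt with h0 | h0
    · rw [quad_eq_zero_of_supp_le hV h h0.symm, zero_mul, zero_mul]
    · exact mul_le_mul_of_nonneg_left (Real.log_le_log h0 (by linarith)) (quad_nonneg hτ _ _)
  · rw [umegaki, if_neg h]
    exact le_top

lemma supp_le_of_quad_eq_zero {τ : Matrix I I ℂ} (hτ : τ.PosSemidef) {V : Matrix I I ℂ}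
    (hV : IsUnitaryMat V) {s : I → ℝ} (h : ∀ j, s j = 0 → quad V τ j = 0) :
    supp τ ≤ supp (ofSpectrum V s) := by
  have hcol : ∀ j, s j = 0 → ∀ i, (τ * V) i j = 0 := by
    intro j hj i
    obtain ⟨P, t, hP, ht, rfl⟩ := exists_ofSpectrum_nonneg hτ
    have h1 := h j hj
    rw [quad_ofSpectrum, Finset.sum_eq_zero_iff_of_nonneg
      fun k _ => mul_nonneg (overlap_nonneg _ _ _ _) (ht k)] at h1
    rw [ofSpectrum, Matrix.mul_assoc, Matrix.mul_assoc, Matrix.mul_apply]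
    refine Finset.sum_eq_zero fun k _ => ?_
    rw [diagonal_mul]
    rcases mul_eq_zero.1 (h1 k (Finset.mem_univ _)) with h2 | h2
    · rw [overlap, Complex.normSq_eq_zero] at h2
      rw [h2, mul_zero, mul_zero]
    · rw [h2, Complex.ofReal_zero, zero_mul, mul_zero]
  have hright : τ * ofSpectrum V (fun j => s j * (s j)⁻¹) = τ := by
    have h1 : τ * V * diagonal (fun j => ((s j * (s j)⁻¹ : ℝ) : ℂ)) = τ * V := by
      ext i j
      rw [mul_diagonal]
      by_cases hj : s j = 0
      · rw [hcol j hj, zero_mul]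
      · rw [mul_inv_cancel₀ hj, Complex.ofReal_one, mul_one]
    rw [ofSpectrum, ← Matrix.mul_assoc, ← Matrix.mul_assoc, h1, Matrix.mul_assoc, hV.2,
      Matrix.mul_one]
  have hleft := congrArg conjTranspose hright
  rw [conjTranspose_mul, (ofSpectrum_isHermitian V _).eq, hτ.1.eq, ← ofSpectrum_mul hV,
    Matrix.mul_assoc] at hleft
  exact supp_le_iff.2 ⟨_, hleft.symm⟩

/-- A uniform bound on the regularized relative entropies forces the support condition, and passes
to the limit `ε ↘ 0`. -/
lemma umegaki_le_of_regEntropy_le {τ σ : Matrix I I ℂ} (hτ : IsState τ) (hσ : IsState σ) {C : ℝ}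
    (h : ∀ ε, 0 < ε → regEntropy τ σ ε ≤ C) : umegaki τ σ ≤ C := by
  obtain ⟨V, s, hV, hs, rfl⟩ := exists_ofSpectrum_nonneg hσ.1
  simp only [regEntropy_ofSpectrum hV] at h
  set w : I → ℝ := fun j => quad V τ j with hw
  have hw0 : ∀ j, 0 ≤ w j := fun j => quad_nonneg hτ.1 _ _
  have hwsum : ∑ j, w j = 1 := hτ.sum_quad hV
  have hzero : ∀ j, s j = 0 → w j = 0 := by
    intro j hj
    by_contra hne
    have hpos : 0 < w j := lt_of_le_of_ne (hw0 j) (Ne.symm hne)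
    -- For `ε = exp (-M)`, the `j`-th term of the sum is `-M * w j`, the others are at most `w i`.
    set M : ℝ := max 0 ((1 + C - negEntropy τ) / w j) + 1 with hM
    have hM0 : 0 ≤ M := by positivity
    have hM1 : (1 + C - negEntropy τ) / w j < M :=
      (le_max_right 0 _).trans_lt (lt_add_one _)
    rw [div_lt_iff₀ hpos] at hM1
    have h1 := h (Real.exp (-M)) (Real.exp_pos _)
    have hexp1 : Real.exp (-M) ≤ 1 := Real.exp_le_one_iff.2 (by linarith)
    have hub : ∑ i, w i * Real.log (s i + Real.exp (-M)) ≤ ∑ i, w i - M * w j := by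
      have hterm : ∀ i, w i * Real.log (s i + Real.exp (-M)) ≤
          w i - if i = j then M * w j else 0 := by
        intro i
        by_cases hij : i = j
        · subst hij
          rw [hj, zero_add, Real.log_exp, if_pos rfl]
          nlinarith
        · rw [if_neg hij, sub_zero]
          refine mul_le_of_le_one_right (hw0 i) ?_
          have hsi := hσ.le_one hV hs i
          have := Real.log_le_sub_one_of_pos
            (add_pos_of_nonneg_of_pos (hs i) (Real.exp_pos (-M)))
          linarith
      refine (Finset.sum_le_sum fun i _ => hterm i).trans (le_of_eq ?_)
      rw [Finset.sum_sub_distrib]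
      simp
    linarith
  rw [umegaki, if_pos (supp_le_of_quad_eq_zero hτ.1 hV hzero), EReal.coe_le_coe_iff,
    umegaki_real_eq hV rfl]
  have hlim : Tendsto (fun ε => negEntropy τ - ∑ j, w j * Real.log (s j + ε)) (𝓝[>] 0)
      (𝓝 (negEntropy τ - ∑ j, w j * Real.log (s j))) := by
    refine tendsto_const_nhds.sub (tendsto_finsetSum _ fun j _ => ?_)
    rcases (hs j).eq_or_lt with h0 | h0
    · simp [hzero j h0.symm]
    · have hc : ContinuousAt (fun ε : ℝ => w j * Real.log (s j + ε)) 0 := by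
        refine continuousAt_const.mul (ContinuousAt.log (by fun_prop) (by simpa using h0.ne'))
      have := hc.tendsto
      rw [add_zero] at this
      exact this.mono_left nhdsWithin_le_nhds
  exact le_of_tendsto hlim (eventually_mem_nhdsWithin.mono fun ε hε => h ε hε)

lemma regEntropy_convex {τ τ' : Matrix I I ℂ} (hτ : τ.PosSemidef) (hτ' : τ'.PosSemidef)
    (σ : Matrix I I ℂ) (ε : ℝ) {a b : ℝ} (ha : 0 ≤ a) (hb : 0 ≤ b) (hab : a + b = 1) :
    regEntropy (a • τ + b • τ') σ ε ≤ a * regEntropy τ σ ε + b * regEntropy τ' σ ε := by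
  have h1 := negEntropy_convex hτ hτ' ha hb hab
  unfold regEntropy
  rw [Matrix.add_mul, Matrix.trace_add, Matrix.smul_mul, Matrix.smul_mul, Matrix.trace_smul,
    Matrix.trace_smul, Complex.add_re, Complex.smul_re, Complex.smul_re, smul_eq_mul, smul_eq_mul]
  linarith

lemma isClosed_regEntropy_le (σ : Matrix I I ℂ) (ε C : ℝ) :
    IsClosed {τ ∈ states I | regEntropy τ σ ε ≤ C} := by
  have h : {τ ∈ states I | regEntropy τ σ ε ≤ C} = states I ∩
      ⋂ U ∈ {U : Matrix I I ℂ | IsUnitaryMat U},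
        {τ | ∑ i, quad U τ i * Real.log (quad U τ i) -
          (τ * logOnSupp (σ + ε • (1 : Matrix I I ℂ))).trace.re ≤ C} := by
    ext τ
    simp only [Set.mem_ofPred_eq, Set.mem_inter_iff, Set.mem_iInter]
    refine and_congr_right fun hτ => ⟨fun h U hU => ?_, fun h => ?_⟩
    · have := sum_quad_mul_log_le hτ.1 hU
      rw [regEntropy] at h
      linarith
    · obtain ⟨U, hU, hUeq⟩ := exists_sum_quad_mul_log_eq hτ.1
      rw [regEntropy, ← hUeq]
      exact h U hU
  rw [h]
  refine isClosed_states.inter (isClosed_biInter fun U _ => isClosed_le (Continuous.sub ?_ ?_)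
    continuous_const)
  · exact continuous_finsetSum _ fun i _ => Real.continuous_mul_log.comp (continuous_quad U i)
  · exact Complex.continuous_re.comp (continuous_id.matrix_mul continuous_const).matrix_trace

end RegEntropy

/-! ### The log-Euclidean Chernoff divergence and the left Umegaki radius -/

section Chernoff

variable {A : Type*} [Fintype A] [DecidableEq A] {r : ℕ} {ρ : Fin r → Matrix A A ℂ}
  {s : Fin r → ℝ}

lemma isHermitian_sum_smul_log (hρ : ∀ x, IsState (ρ x)) (s : Fin r → ℝ) (ε : ℝ) :
    (∑ x, s x • logOnSupp (ρ x + ε • (1 : Matrix A A ℂ))).IsHermitian := by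
  have h : ∀ x, (s x • logOnSupp (ρ x + ε • (1 : Matrix A A ℂ))).IsHermitian := by
    intro x
    obtain ⟨V, d, hV, -, hd⟩ := exists_ofSpectrum_nonneg (hρ x).1
    rw [hd, logOnSupp_add_smul_one hV, ofSpectrum_smul]
    exact ofSpectrum_isHermitian _ _
  rw [Matrix.IsHermitian, Matrix.conjTranspose_sum]
  exact Finset.sum_congr rfl fun x _ => (h x).eq

lemma sum_mul_regEntropy (hs : s ∈ stdSimplex ℝ (Fin r)) (τ : Matrix A A ℂ) (ε : ℝ) :
    ∑ x, s x * regEntropy τ (ρ x) ε =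
      negEntropy τ - (τ * ∑ x, s x • logOnSupp (ρ x + ε • (1 : Matrix A A ℂ))).trace.re := by
  rw [Finset.mul_sum, Matrix.trace_sum, Complex.re_sum]
  simp only [regEntropy, mul_sub, Finset.sum_sub_distrib, ← Finset.sum_mul, hs.2, one_mul,
    Matrix.mul_smul, Matrix.trace_smul, Complex.smul_re, smul_eq_mul]

lemma logEuclideanReg_eq [Nonempty A] (hρ : ∀ x, IsState (ρ x)) (s : Fin r → ℝ) (ε : ℝ) :
    logEuclideanReg ρ s ε = ((-Real.log
      (expHerm (∑ x, s x • logOnSupp (ρ x + ε • (1 : Matrix A A ℂ)))).trace.re : ℝ) : EReal) :=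
  negLog_of_pos (trace_expHerm_pos (isHermitian_sum_smul_log hρ s ε))

lemma logEuclideanReg_le (hρ : ∀ x, IsState (ρ x)) (hs : s ∈ stdSimplex ℝ (Fin r)) (ε : ℝ)
    {τ : Matrix A A ℂ} (hτ : IsState τ) :
    logEuclideanReg ρ s ε ≤ ((∑ x, s x * regEntropy τ (ρ x) ε : ℝ) : EReal) := by
  have := hτ.nonempty
  rw [logEuclideanReg_eq hρ, EReal.coe_le_coe_iff, sum_mul_regEntropy hs]
  exact neg_log_trace_expHerm_le (isHermitian_sum_smul_log hρ s ε) hτ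

lemma exists_logEuclideanReg_eq [Nonempty A] (hρ : ∀ x, IsState (ρ x))
    (hs : s ∈ stdSimplex ℝ (Fin r)) (ε : ℝ) :
    ∃ τ, IsState τ ∧
      logEuclideanReg ρ s ε = ((∑ x, s x * regEntropy τ (ρ x) ε : ℝ) : EReal) := by
  obtain ⟨τ, hτ, h⟩ := exists_neg_log_trace_expHerm_eq (isHermitian_sum_smul_log hρ s ε)
  exact ⟨τ, hτ, by rw [logEuclideanReg_eq hρ, h, sum_mul_regEntropy hs]⟩

lemma antitoneOn_logEuclideanReg [Nonempty A] (hρ : ∀ x, IsState (ρ x))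
    (hs : s ∈ stdSimplex ℝ (Fin r)) : AntitoneOn (logEuclideanReg ρ s) (Set.Ioi 0) := by
  intro ε hε ε' _ hle
  obtain ⟨τ, hτ, h⟩ := exists_logEuclideanReg_eq hρ hs ε
  rw [h]
  refine (logEuclideanReg_le hρ hs ε' hτ).trans (EReal.coe_le_coe_iff.2 ?_)
  exact Finset.sum_le_sum fun x _ =>
    mul_le_mul_of_nonneg_left (regEntropy_anti hτ.1 (hρ x).1 hε hle) (hs.1 x)

lemma tendsto_logEuclideanReg [Nonempty A] (hρ : ∀ x, IsState (ρ x))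
    (hs : s ∈ stdSimplex ℝ (Fin r)) :
    Tendsto (logEuclideanReg ρ s) (𝓝[>] 0) (𝓝 (sSup (logEuclideanReg ρ s '' Set.Ioi 0))) :=
  (antitoneOn_logEuclideanReg hρ hs).tendsto_nhdsGT (OrderTop.bddAbove _)

lemma logEuclideanChernoff_eq [Nonempty A] (hρ : ∀ x, IsState (ρ x)) :
    logEuclideanChernoff ρ =
      ⨆ s ∈ stdSimplex ℝ (Fin r), sSup (logEuclideanReg ρ s '' Set.Ioi 0) :=
  iSup_congr fun _ => iSup_congr fun hs => (tendsto_logEuclideanReg hρ hs).limUnder_eq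

lemma logEuclideanChernoff_le_umegakiRadius [Nonempty A] (hρ : ∀ x, IsState (ρ x)) :
    logEuclideanChernoff ρ ≤ umegakiRadius ρ := by
  rw [logEuclideanChernoff_eq hρ]
  refine iSup₂_le fun s hs => sSup_le ?_
  rintro _ ⟨ε, hε, rfl⟩
  refine le_iInf₂ fun τ hτ => EReal.le_of_forall_lt_iff_le.1 fun b hb => ?_
  have hτ' : IsState τ := hτ
  refine (logEuclideanReg_le hρ hs ε hτ').trans (EReal.coe_le_coe_iff.2 ?_)
  have hx : ∀ x, regEntropy τ (ρ x) ε ≤ b := fun x => EReal.coe_le_coe_iff.1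
    ((regEntropy_le_umegaki hτ'.1 (hρ x).1 hε).trans ((le_iSup _ x).trans hb.le))
  calc ∑ x, s x * regEntropy τ (ρ x) ε ≤ ∑ x, s x * b :=
        Finset.sum_le_sum fun x _ => mul_le_mul_of_nonneg_left (hx x) (hs.1 x)
    _ = b := by rw [← Finset.sum_mul, hs.2, one_mul]

/-- The minimax step at a fixed regularization `ε`. -/
lemma exists_regEntropy_le [Nonempty A] (hr : 0 < r) (hρ : ∀ x, IsState (ρ x)) {C : ℝ}
    (hC : logEuclideanChernoff ρ < C) {ε : ℝ} (hε : 0 < ε) :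
    ∃ τ ∈ states A, ∀ x, regEntropy τ (ρ x) ε ≤ C := by
  by_contra! hcon
  have : Nonempty (Fin r) := ⟨⟨0, hr⟩⟩
  have hconv : Convex ℝ {d : Fin r → ℝ | ∃ τ ∈ states A, ∀ x, regEntropy τ (ρ x) ε ≤ d x} := by
    rintro d ⟨τ, hτ, hd⟩ d' ⟨τ', hτ', hd'⟩ a b ha hb hab
    refine ⟨a • τ + b • τ', isState_smul_add hτ hτ' ha hb hab, fun x => ?_⟩
    exact (regEntropy_convex hτ.1 hτ'.1 _ _ ha hb hab).trans
      (add_le_add (mul_le_mul_of_nonneg_left (hd x) ha) (mul_le_mul_of_nonneg_left (hd' x) hb))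
  obtain ⟨s, hs, h⟩ := exists_stdSimplex_of_convex hconv (v := C) (by
    rintro d ⟨τ, hτ, hd⟩
    obtain ⟨x, hx⟩ := hcon τ hτ
    exact ⟨x, hx.le.trans (hd x)⟩)
  obtain ⟨τ, hτ, heq⟩ := exists_logEuclideanReg_eq hρ hs ε
  have h1 : (C : EReal) ≤ logEuclideanReg ρ s ε := by
    rw [heq, EReal.coe_le_coe_iff]
    exact h _ ⟨τ, hτ, fun x => le_rfl⟩
  have h2 : logEuclideanReg ρ s ε ≤ logEuclideanChernoff ρ := by
    rw [logEuclideanChernoff_eq hρ]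
    exact le_iSup₂_of_le s hs (le_sSup ⟨ε, hε, rfl⟩)
  exact absurd hC (not_lt.2 (h1.trans h2))

/-- The near-optimal states for `ε = 1/(k+1)` form a decreasing sequence of nonempty compact sets;
a state in all of them is near-optimal for the unregularized radius. -/
lemma umegakiRadius_le_logEuclideanChernoff [Nonempty A] (hr : 0 < r)
    (hρ : ∀ x, IsState (ρ x)) : umegakiRadius ρ ≤ logEuclideanChernoff ρ := by
  refine EReal.le_of_forall_lt_iff_le.1 fun C hC => ?_
  set N : ℕ → Set (Matrix A A ℂ) := fun k =>
    states A ∩ ⋂ x, {τ ∈ states A | regEntropy τ (ρ x) (1 / ((k : ℝ) + 1)) ≤ C} with hN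
  have hpos : ∀ k : ℕ, (0 : ℝ) < 1 / ((k : ℝ) + 1) := fun k => Nat.one_div_pos_of_nat
  have hclosed : ∀ k, IsClosed (N k) := fun k =>
    isClosed_states.inter (isClosed_iInter fun x => isClosed_regEntropy_le _ _ _)
  have hanti : ∀ k, N (k + 1) ⊆ N k := by
    rintro k τ ⟨hτ, h⟩
    refine ⟨hτ, Set.mem_iInter.2 fun x => ⟨hτ, ?_⟩⟩
    refine le_trans (regEntropy_anti hτ.1 (hρ x).1 (hpos (k + 1)) ?_) (Set.mem_iInter.1 h x).2
    exact Nat.one_div_le_one_div (Nat.le_succ k)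
  have hne : ∀ k, (N k).Nonempty := by
    intro k
    obtain ⟨τ, hτ, h⟩ := exists_regEntropy_le hr hρ hC (hpos k)
    exact ⟨τ, hτ, Set.mem_iInter.2 fun x => ⟨hτ, h x⟩⟩
  obtain ⟨τ, hτ⟩ := IsCompact.nonempty_iInter_of_sequence_nonempty_isCompact_isClosed N hanti hne
    (isCompact_states.inter_right (isClosed_iInter fun x => isClosed_regEntropy_le _ _ _)) hclosed
  rw [Set.mem_iInter] at hτ
  have hτs : IsState τ := (hτ 0).1
  refine iInf₂_le_of_le τ hτs (iSup_le fun x => umegaki_le_of_regEntropy_le hτs (hρ x) ?_)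
  intro ε hε
  obtain ⟨k, hk⟩ := exists_nat_one_div_lt hε
  exact (regEntropy_anti hτs.1 (hρ x).1 (hpos k) hk.le).trans (Set.mem_iInter.1 (hτ k).2 x).2

end Chernoff

end StateExclusion

open StateExclusion
theorem theorem3 {A : Type*} [Fintype A] [DecidableEq A] {r : ℕ}
    (p : Fin r → ℝ) (hp_pos : ∀ x, 0 < p x) (hp_sum : ∑ x, p x = 1)
    (ρ : Fin r → Matrix A A ℂ) (hρ : ∀ x, IsState (ρ x)) :
    errorExponentLimsup p ρ ≤ regularizedRadius ρ ∧
    regularizedRadius ρ ≤ logEuclideanChernoff ρ ∧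
    errorExponentLimsup p ρ ≤ logEuclideanChernoff ρ ∧
    (∀ s ∈ stdSimplex ℝ (Fin r),
      ∃ l : EReal, Tendsto (logEuclideanReg ρ s) (𝓝[>] (0 : ℝ)) (𝓝 l)) ∧
    logEuclideanChernoff ρ = umegakiRadius ρ := by
  have hr : 0 < r := by
    rcases Nat.eq_zero_or_pos r with rfl | hr
    · simp at hp_sum
    · exact hr
  have hA : Nonempty A := (hρ ⟨0, hr⟩).nonempty
  have heq : logEuclideanChernoff ρ = umegakiRadius ρ :=
    le_antisymm (logEuclideanChernoff_le_umegakiRadius hρ)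
      (umegakiRadius_le_logEuclideanChernoff hr hρ)
  have h1 := errorExponentLimsup_le_regularizedRadius hρ hp_pos hr
  have h2 : regularizedRadius ρ ≤ logEuclideanChernoff ρ :=
    heq ▸ regularizedRadius_le_umegakiRadius hρ
  exact ⟨h1, h2, h1.trans h2, fun s hs => ⟨_, tendsto_logEuclideanReg hρ hs⟩, heq⟩
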